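/- **Setting.** Let $\mathcal X$ (prompts) and $\mathcal A$ (responses) be measurable spaces, $d_0$ a probability distribution on $\mathcal X$, $\pi_0(\cdot|x)$ a probability kernel from $\mathcal X$ to $\mathcal A$ (the initial policy), $\eta>0$, $B>0$, and $\phi:\mathcal X\times\mathcal A\to\mathbb R^d$ measurable with $\|\phi\|\le 1$. For $\theta\in\mathbb R^d$ put $r_\theta(x,a)=\langle\theta,\phi(x,a)\rangle$. The true reward $r^*:\mathcal X\times\mathcal A\to[0,1]$ equals $r_{\theta^*}$ for some $\|\theta^*\|\le B$. Put $\gamma=1/(2+e^{-B}+e^{B})$, $\sigma(z)=1/(1+e^{-z})$, and for a policy $\pi$ put $\phi(x,\pi)=\mathbb E_{a\sim\pi(\cdot|x)}\phi(x,a)$. Let $\Pi=\{\pi_\theta:\|\theta\|\le B\}$ with $\pi_\theta(\cdot|x)\propto\pi_0(\cdot|x)\exp(r_\theta(x,\cdot)/\eta)$. For a reward $r$ let $J_r(\pi)=\mathbb E_{x\sim d_0}\big[\mathbb E_{a\sim\pi(\cdot|x)}r(x,a)-\eta D_{\mathrm{KL}}(\pi(\cdot|x)\|\pi_0(\cdot|x))\big]$,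 $J=J_{r^*}$, and let $\pi^*\in\arg\max_{\pi\in\Pi}J(\pi)$. **Algorithm** (online iterative GSHF, Option II, batch size $m=1$, no offline data; parameters $\lambda,\beta>0$). In round $t=1,\dots,T$, let $\mathcal D^{1:t-1}=\{(x_s,a_s^1,a_s^2,y_s)\}_{s<t}$ be the data so far and $\Sigma_t=\lambda I+\sum_{s<t}(\phi(x_s,a_s^1)-\phi(x_s,a_s^2))(\phi(x_s,a_s^1)-\phi(x_s,a_s^2))^\top$. * $\theta_t$ maximizes over $\|\theta\|\le B$ the log-likelihood $\sum_{s<t}\big[y_s\log\sigma(r_\theta(x_s,a_s^1)-r_\theta(x_s,a_s^2))+(1-y_s)\log\sigma(r_\theta(x_s,a_s^2)-r_\theta(x_s,a_s^1))\big]$, and the main agent plays $\pi_t^1\in\arg\max_{\pi\in\Pi}J_{r_{\theta_t}}(\pi)$. * A prompt $x_t\sim d_0$ is observed. With $\Gamma_t(\pi')=\beta\|\phi(x_t,\pi')-\phi(x_t,\pi_t^1)\|_{\Sigma_t^{-1}}$, the enhancer plays $\pi_t^2\in\arg\max_{\pi'\in\Pi_t}\Gamma_t(\pi')$, where $\Pi_t=\{\pi'\in\Pi:\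 \eta\,\mathbb E_{x\sim d_0}D_{\mathrm{KL}}(\pi'(\cdot|x)\|\pi_t^1(\cdot|x))\le\Gamma_t(\pi')\}$. * Independently $a_t^1\sim\pi_t^1(\cdot|x_t)$ and $a_t^2\sim\pi_t^2(\cdot|x_t)$; then $y_t\in\{0,1\}$ with $\mathbb P(y_t=1)=\sigma(r^*(x_t,a_t^1)-r^*(x_t,a_t^2))$. Ties are broken by any measurable rule. Put $$\mathrm{Reg}(T)=\sum_{t=1}^T\big[J(\pi^*)-J(\pi_t^1)\big],\qquad \mathrm{Reg}_{\mathrm{ave}}(T)=\sum_{t=1}^T\frac{2J(\pi^*)-J(\pi_t^1)-J(\pi_t^2)}2 .$$ **Theorem.** There is an absolute constant $c_\beta>0$ such that for every $c_\lambda>0$ there is a constant $K>0$ (depending only on $c_\lambda$) with the following property. In every instance of the setting above, for all $T\ge1$, $\delta\in(0,1)$, and all $\lambda>0$, $\beta$ with $$\lambda\ \ge\ c_\lambda\,\frac{d\log(T/\delta)}{\gamma^2B^2},\qquad \beta\ \ge\ c_\beta\sqrt{\frac{d\log(T/\delta)}{\gamma^2}+\lambda B^2}$$ (so that for $\lambda\asymp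 d\log(T/\delta)/(\gamma^2B^2)$ one may take $\beta\asymp\sqrt{d\log(T/\delta)/\gamma^2}$), with probability at least $1-2\delta$ both of the following hold: $$\mathrm{Reg}_{\mathrm{ave}}(T)\le K\sqrt{T\beta^2 d\,\log\!\Big(1+\frac{T}{d\lambda}\Big)}-\eta\sum_{t=1}^T\mathbb E_{x\sim d_0}\big[D_{\mathrm{KL}}(\pi^*(\cdot|x)\|\pi_t^1(\cdot|x))\big],$$ $$\mathrm{Reg}(T)\le K\sqrt{T\beta^2 d\,\log\!\Big(1+\frac{T}{d\lambda}\Big)}-\eta\sum_{t=1}^T\mathbb E_{x\sim d_0}\big[D_{\mathrm{KL}}(\pi^*(\cdot|x)\|\pi_t^1(\cdot|x))\big].$$ -/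

import Mathlib

open MeasureTheory ProbabilityTheory
open scoped ENNReal

namespace GSHF

/-- The feature space `ℝ^d` with the Euclidean norm. -/
abbrev Feat (d : ℕ) := EuclideanSpace ℝ (Fin d)

/-- A policy maps each prompt to a (probability) measure on responses. -/
abbrev Policy (X A : Type*) [MeasurableSpace A] := X → Measure A

/-- One round of interaction `(x, a¹, a², y)`; `y = true` means that `a¹` is preferred to `a²`. -/
abbrev Round (X A : Type*) := X × A × A × Bool

/-- The data of the KL-regularized contextual bandit: prompt distribution `d₀`, initial policy `π₀`,
ground-truth reward `r*`, feature map `φ`, KL coefficient `η` and parameter radius `B`. -/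
structure Model (X A : Type*) [MeasurableSpace X] [MeasurableSpace A] (d : ℕ) where
  d₀ : Measure X
  π₀ : Kernel X A
  rStar : X → A → ℝ
  φ : X → A → Feat d
  η : ℝ
  B : ℝ

variable {X A : Type*} [MeasurableSpace X] [MeasurableSpace A] {d : ℕ}

namespace Model

/-- The standing assumptions: `d₀` and `π₀` are probability distributions, `η, B > 0`, the reward
takes values in `[0,1]`, and the linear model `r* = ⟨θ*, φ⟩`, `‖φ‖ ≤ 1`, `‖θ*‖ ≤ B`. -/
structure LinearAssumption (M : Model X A d) : Prop where
  prob_d₀ : IsProbabilityMeasure M.d₀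
  markov_π₀ : IsMarkovKernel M.π₀
  measurable_φ : Measurable (Function.uncurry M.φ)
  η_pos : 0 < M.η
  B_pos : 0 < M.B
  reward_mem : ∀ x a, M.rStar x a ∈ Set.Icc (0 : ℝ) 1
  norm_φ_le : ∀ x a, ‖M.φ x a‖ ≤ 1
  linear : ∃ θStar : Feat d, ‖θStar‖ ≤ M.B ∧ ∀ x a, M.rStar x a = inner ℝ θStar (M.φ x a)

/-- `γ = 1 / (2 + exp(-B) + exp(B))`. -/
noncomputable def γ (M : Model X A d) : ℝ := 1 / (2 + Real.exp (-M.B) + Real.exp M.B)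

/-- The linear reward `r_θ(x,a) = ⟨θ, φ(x,a)⟩`. -/
noncomputable def reward (M : Model X A d) (θ : Feat d) (x : X) (a : A) : ℝ :=
  inner ℝ θ (M.φ x a)

/-- The Gibbs policy `π_θ(·|x) ∝ π₀(·|x) exp(r_θ(x,·)/η)`. -/
noncomputable def gibbs (M : Model X A d) (θ : Feat d) : Policy X A :=
  fun x => (M.π₀ x).tilted (fun a => M.reward θ x a / M.η)

/-- The policy class `Π` of Gibbs policies with `‖θ‖ ≤ B`. -/
def policyClass (M : Model X A d) : Set (Policy X A) :=
  M.gibbs '' Metric.closedBall 0 M.B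

/-- `E_{x ∼ d₀} D_KL(π(·|x) ‖ π'(·|x))`. -/
noncomputable def expKL (M : Model X A d) (π π' : Policy X A) : ℝ :=
  ∫ x, (InformationTheory.klDiv (π x) (π' x)).toReal ∂M.d₀

/-- The KL-regularized value of `π` for a reward function `r`:
`E_{x ∼ d₀} [ E_{a ∼ π(·|x)} r(x,a) - η D_KL(π(·|x) ‖ π₀(·|x)) ]`. -/
noncomputable def value (M : Model X A d) (r : X → A → ℝ) (π : Policy X A) : ℝ :=
  ∫ x, ((∫ a, r x a ∂(π x)) - M.η * (InformationTheory.klDiv (π x) (M.π₀ x)).toReal) ∂M.d₀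

/-- The target `J(π)`. -/
noncomputable def J (M : Model X A d) (π : Policy X A) : ℝ := M.value M.rStar π

/-- `π*`: a maximizer of `J` over `Π`. -/
def IsOptimal (M : Model X A d) (πStar : Policy X A) : Prop :=
  πStar ∈ M.policyClass ∧ IsMaxOn M.J M.policyClass πStar

/-- The mean feature `φ(x, π) = E_{a ∼ π(·|x)} φ(x,a)`. -/
noncomputable def meanφ (M : Model X A d) (x : X) (π : Policy X A) : Feat d :=
  ∫ a, M.φ x a ∂(π x)

/-- The Bradley-Terry log-likelihood of `θ` on a dataset. -/
noncomputable def logLik (M : Model X A d) {t : ℕ} (D : Fin t → Round X A) (θ : Feat d) : ℝ :=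
  ∑ i, match D i with
    | (x, a₁, a₂, true) => Real.log (Real.sigmoid (M.reward θ x a₁ - M.reward θ x a₂))
    | (x, a₁, a₂, false) => Real.log (Real.sigmoid (M.reward θ x a₂ - M.reward θ x a₁))

/-- `θ` is a maximum likelihood estimator over `Θ(B)`. -/
def IsMLE (M : Model X A d) {t : ℕ} (D : Fin t → Round X A) (θ : Feat d) : Prop :=
  θ ∈ Metric.closedBall 0 M.B ∧ IsMaxOn (M.logLik D) (Metric.closedBall 0 M.B) θ

/-- The covariance matrix `Σ_D = lam I + ∑ (φ(x,a¹) - φ(x,a²)) (φ(x,a¹) - φ(x,a²))ᵀ`. -/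
noncomputable def cov (M : Model X A d) (lam : ℝ) {t : ℕ} (D : Fin t → Round X A) :
    Matrix (Fin d) (Fin d) ℝ :=
  lam • (1 : Matrix (Fin d) (Fin d) ℝ) + ∑ i,
    Matrix.vecMulVec (M.φ (D i).1 (D i).2.1 - M.φ (D i).1 (D i).2.2.1).ofLp
      (M.φ (D i).1 (D i).2.1 - M.φ (D i).1 (D i).2.2.1).ofLp

end Model

/-- The induced norm `‖z‖_S = √(zᵀ S z)`. -/
noncomputable def matNorm (S : Matrix (Fin d) (Fin d) ℝ) (z : Feat d) : ℝ :=
  Real.sqrt (z.ofLp ⬝ᵥ S.mulVec z.ofLp)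

namespace Model

/-- The uncertainty `Γ(lam, π¹, π') = β ‖φ(x,π') - φ(x,π¹)‖_{Σ_D⁻¹}` at the observed prompt `x`. -/
noncomputable def bonus (M : Model X A d) (lam β : ℝ) {t : ℕ} (D : Fin t → Round X A) (x : X)
    (π₁ π' : Policy X A) : ℝ :=
  β * matNorm (M.cov lam D)⁻¹ (M.meanφ x π' - M.meanφ x π₁)

/-- The set `Π_t = {π' ∈ Π : η E_{x ∼ d₀} D_KL(π' ‖ π¹) ≤ Γ(lam, π¹, π')}`. -/
def confSet (M : Model X A d) (lam β : ℝ) {t : ℕ} (D : Fin t → Round X A) (x : X)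
    (π₁ : Policy X A) : Set (Policy X A) :=
  {π' ∈ M.policyClass | M.η * M.expKL π' π₁ ≤ M.bonus lam β D x π₁ π'}

/-- Online Iterative GSHF with Option II, batch size one and no offline data, as a rule that maps
the data of the first `t` rounds (and, for the enhancer, also the prompt just observed) to the
policies of the next round. Ties in the arg max are broken arbitrarily, but measurably: `main t`
and `enhancer t` are kernels in (data, evaluated prompt) and
(data, observed prompt, evaluated prompt). -/
structure OptionII (M : Model X A d) (lam β : ℝ) where
  θMLE : ∀ t : ℕ, (Fin t → Round X A) → Feat d
  main : ∀ t : ℕ, Kernel ((Fin t → Round X A) × X) A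
  enhancer : ∀ t : ℕ, Kernel ((Fin t → Round X A) × X × X) A
  isMLE : ∀ t D, M.IsMLE D (θMLE t D)
  main_mem : ∀ t D, (fun x => main t (D, x)) ∈ M.policyClass
  main_max : ∀ t D,
    IsMaxOn (M.value (M.reward (θMLE t D))) M.policyClass (fun x => main t (D, x))
  enhancer_mem : ∀ t D xObs, (fun x => enhancer t (D, xObs, x)) ∈
    M.confSet lam β D xObs (fun x => main t (D, x))
  enhancer_max : ∀ t D xObs,
    IsMaxOn (M.bonus lam β D xObs (fun x => main t (D, x)))
      (M.confSet lam β D xObs (fun x => main t (D, x))) (fun x => enhancer t (D, xObs, x))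

end Model

section Run

variable {Ω : Type*}

/-- The data of the first `t` rounds. -/
def hist (Z : ℕ → Ω → Round X A) (t : ℕ) (ω : Ω) : Fin t → Round X A := fun i => Z i ω

variable {M : Model X A d} {lam β : ℝ}

/-- The main agent's policy `π¹` in the round that follows the first `t` rounds. -/
noncomputable def mainPolicy (alg : M.OptionII lam β) (Z : ℕ → Ω → Round X A) (t : ℕ) (ω : Ω) :
    Policy X A :=
  fun x => alg.main t (hist Z t ω, x)

/-- The enhancer's policy `π²` in the round that follows the first `t` rounds. -/
noncomputable def enhancerPolicy (alg : M.OptionII lam β) (Z : ℕ → Ω → Round X A) (t : ℕ)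
    (ω : Ω) : Policy X A :=
  fun x => alg.enhancer t (hist Z t ω, (Z t ω).1, x)

/-- `Z 0, …, Z (T-1)` are the rounds of a run of the algorithm: given the data `D` of the first `t`
rounds, `x ∼ d₀`; given also `x`, independently `a¹ ∼ π¹(·|x)` and `a² ∼ π²(·|x)`; and given
`(D, x, a¹, a²)`, `a¹` is preferred with the Bradley-Terry probability
`σ(r*(x,a¹) - r*(x,a²))`. -/
structure IsRun [MeasurableSpace Ω] (alg : M.OptionII lam β) (P : Measure Ω)
    (T : ℕ) (Z : ℕ → Ω → Round X A) : Prop where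
  measurable : ∀ t, Measurable (Z t)
  law : ∀ t < T, ∀ F : (Fin t → Round X A) → Round X A → ℝ≥0∞,
    Measurable (Function.uncurry F) →
    ∫⁻ ω, F (hist Z t ω) (Z t ω) ∂P =
      ∫⁻ ω, ∫⁻ x, ∫⁻ a₁, ∫⁻ a₂,
        (ENNReal.ofReal (Real.sigmoid (M.rStar x a₁ - M.rStar x a₂)) *
            F (hist Z t ω) (x, a₁, a₂, true) +
          ENNReal.ofReal (Real.sigmoid (M.rStar x a₂ - M.rStar x a₁)) *
            F (hist Z t ω) (x, a₁, a₂, false))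
        ∂(alg.enhancer t (hist Z t ω, x, x)) ∂(alg.main t (hist Z t ω, x)) ∂M.d₀ ∂P

/-- `Reg(T) = ∑_t [J(π*) - J(π_t¹)]`. -/
noncomputable def regret (alg : M.OptionII lam β) (Z : ℕ → Ω → Round X A) (πStar : Policy X A)
    (T : ℕ) (ω : Ω) : ℝ :=
  ∑ t ∈ Finset.range T, (M.J πStar - M.J (mainPolicy alg Z t ω))

/-- `Reg_ave(T) = ∑_t [2 J(π*) - J(π_t¹) - J(π_t²)] / 2`. -/
noncomputable def regretAve (alg : M.OptionII lam β) (Z : ℕ → Ω → Round X A)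
    (πStar : Policy X A) (T : ℕ) (ω : Ω) : ℝ :=
  ∑ t ∈ Finset.range T,
    (2 * M.J πStar - M.J (mainPolicy alg Z t ω) - M.J (enhancerPolicy alg Z t ω)) / 2

/-- `∑_t E_{x ∼ d₀} D_KL(π*(·|x) ‖ π_t¹(·|x))`. -/
noncomputable def sumKL (alg : M.OptionII lam β) (Z : ℕ → Ω → Round X A) (πStar : Policy X A)
    (T : ℕ) (ω : Ω) : ℝ :=
  ∑ t ∈ Finset.range T, M.expKL πStar (mainPolicy alg Z t ω)

end Run

end GSHF

/-! Regret. By the Gibbs variational identity, a policy π¹ that is optimal for `r_θ` satisfies, for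
every π in Π, J(π) − J(π¹) = E⟨θ* − θ, φ(x,π) − φ(x,π¹)⟩ − η KL(π‖π¹) exactly
(`value_sub_value_eq`). When 2‖θ* − θ_t‖_{Σ_t} ≤ β, the inner product at a prompt is at most half
the bonus of π there. Either π is admissible for the enhancer at that prompt, so that the enhancer's
bonus dominates, or the bonus is below η KL(π‖π¹) (`abs_inner_meanφ_sub_le`). Hence π* need not lie
in Π_t. The KL part is absorbed using J(π¹) ≤ J(π*), so regret plus the full KL term costs at most β
E√width, where `width` is the squared Σ_t⁻¹-norm of the feature gap between the two agents. The
enhancer's own loss is paid for by its KL constraint.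

Confidence. For fixed θ, the exponential of half the log-likelihood ratio plus a quarter of the
squared difference of Bradley-Terry probabilities has conditional mean at most 1, by a Hellinger
bound. Averaging over a ball of parameters and applying Markov's inequality replaces a covering: the
1/T-neighbourhood of the estimator fills a fraction (1 + BT)^{-d} of the ball. True reward
differences lie in [−1,1], so inverting σ costs a factor linear in B rather than 1/γ. This slack
pays for the d·B left over from the volume ratio, which is what makes c_β absolute.

Widths. By Jensen, the width at the observed prompt is at most the conditional mean of the potential
`gain`. Two exponential supermartingales compare expected widths with observed widths, and observed
widths with gains; the elliptical potential lemma sums the gains. The lower bound on λ makes the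
deviation terms comparable to the information gain (`width_bound`). -/

namespace GSHF

/-! ### Scalar inequalities for the sigmoid and the exponential -/

section RealInequalities

/-- One endpoint in [−1,1] keeps a = e^{-v} in [1/3,3], where (1+a)² ≤ 16a, so the sigmoid gap is at
least (1 − e^{-(u−v)})/16. The loss for large u is then only linear, from 1 − e^{-w} ≥ w/(1+w) with
w + 1 ≤ 2 + 2B. A mean value bound would lose a factor exponential in B. -/
lemma sub_le_sigmoid_sub {u v B : ℝ} (hv : |v| ≤ 1) (hu : |u| ≤ 2 * B) (hvu : v ≤ u) :
    u - v ≤ 32 * (1 + B) * (Real.sigmoid u - Real.sigmoid v) := by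
  obtain ⟨hv1, hv2⟩ := abs_le.1 hv
  obtain ⟨hu1, hu2⟩ := abs_le.1 hu
  have hB : 0 ≤ B := by linarith
  have he : Real.exp 1 ≤ 3 := by linarith [Real.exp_one_lt_d9]
  have hev : Real.exp (-v) ≤ 3 := (Real.exp_le_exp.2 (by linarith)).trans he
  have hev' : 1 ≤ 3 * Real.exp (-v) := by
    have h1 : Real.exp v ≤ 3 := (Real.exp_le_exp.2 (by linarith)).trans he
    have h2 : Real.exp v * Real.exp (-v) = 1 := by rw [← Real.exp_add]; simp
    nlinarith [Real.exp_pos (-v)]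
  have hw : u - v + 1 ≤ Real.exp (u - v) := Real.add_one_le_exp _
  set a := Real.exp (-v) with ha
  set w := u - v with hwdef
  have hw0 : 0 ≤ w := by linarith
  have huexp : Real.exp (-u) = a * Real.exp (-w) := by
    rw [ha, ← Real.exp_add]; congr 1; rw [hwdef]; ring
  set q := Real.exp (-w) with hq
  have hq0 : 0 < q := Real.exp_pos _
  have ha0 : 0 < a := Real.exp_pos _
  have hqw : q * (w + 1) ≤ 1 := by
    have : Real.exp w * q = 1 := by rw [hq, ← Real.exp_add]; simp
    nlinarith
  have hq1 : q ≤ 1 := by nlinarith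
  have hmul : w ≤ (1 - q) * (2 + 2 * B) := by nlinarith
  have hdiff : Real.sigmoid u - Real.sigmoid v = a * (1 - q) / ((1 + a * q) * (1 + a)) := by
    rw [Real.sigmoid_def, Real.sigmoid_def, huexp, ← ha]
    field_simp
    ring
  have hbound : (1 - q) / 16 ≤ a * (1 - q) / ((1 + a * q) * (1 + a)) := by
    rw [div_le_div_iff₀ (by norm_num) (by positivity)]
    have : (1 + a * q) * (1 + a) ≤ 16 * a := by
      have : a * q ≤ a := by nlinarith
      nlinarith
    nlinarith
  rw [hdiff]
  nlinarith

lemma abs_sub_le_abs_sigmoid_sub {u v B : ℝ} (hv : |v| ≤ 1) (hu : |u| ≤ 2 * B) :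
    |u - v| ≤ 32 * (1 + B) * |Real.sigmoid u - Real.sigmoid v| := by
  rcases le_total v u with h | h
  · rw [abs_of_nonneg (sub_nonneg.2 h), abs_of_nonneg (sub_nonneg.2 (Real.sigmoid_le h))]
    exact sub_le_sigmoid_sub hv hu h
  · rw [abs_of_nonpos (sub_nonpos.2 h), abs_of_nonpos (sub_nonpos.2 (Real.sigmoid_le h))]
    have := sub_le_sigmoid_sub (u := -u) (v := -v) (B := B) (by simpa) (by simpa)
      (by linarith)
    rw [Real.sigmoid_neg, Real.sigmoid_neg] at this
    linarith

lemma log_sigmoid_sub_le (u v : ℝ) :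
    Real.log (Real.sigmoid u) - Real.log (Real.sigmoid v) ≤ |u - v| := by
  rw [Real.sigmoid_def, Real.sigmoid_def, Real.log_inv, Real.log_inv]
  have h : 1 + Real.exp (-v) ≤ Real.exp |u - v| * (1 + Real.exp (-u)) := by
    rw [mul_add, ← Real.exp_add, mul_one]
    gcongr
    · exact Real.one_le_exp (abs_nonneg _)
    · linarith [le_abs_self (u - v)]
  have := Real.log_le_log (by positivity) h
  rw [Real.log_mul (by positivity) (by positivity), Real.log_exp] at this
  linarith

/-- The left side is the Hellinger affinity of two Bernoulli laws. One minus it is half the sum of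
two squared differences of square roots, each at least (p − q)²/4 because √p + √q ≤ 2. -/
lemma sqrt_mul_add_sqrt_mul_le_exp {p q : ℝ} (hp : p ∈ Set.Icc (0 : ℝ) 1)
    (hq : q ∈ Set.Icc (0 : ℝ) 1) :
    √(p * q) + √((1 - p) * (1 - q)) ≤ Real.exp (-((p - q) ^ 2 / 4)) := by
  refine le_trans ?_ (Real.add_one_le_exp _)
  obtain ⟨hp0, hp1⟩ := hp
  obtain ⟨hq0, hq1⟩ := hq
  rw [Real.sqrt_mul hp0, Real.sqrt_mul (by linarith)]
  have key : ∀ x y : ℝ, 0 ≤ x → x ≤ 1 → 0 ≤ y → y ≤ 1 → (x - y) ^ 2 ≤ 4 * (√x - √y) ^ 2 := by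
    intro x y hx hx1 hy hy1
    have h1 : x - y = (√x - √y) * (√x + √y) := by
      nlinarith [Real.mul_self_sqrt hx, Real.mul_self_sqrt hy]
    have h2 : √x ≤ 1 := Real.sqrt_le_one.2 hx1
    have h3 : √y ≤ 1 := Real.sqrt_le_one.2 hy1
    have h4 : (√x + √y) ^ 2 ≤ 4 := by nlinarith [Real.sqrt_nonneg x, Real.sqrt_nonneg y]
    rw [h1, mul_pow]
    nlinarith [sq_nonneg (√x - √y)]
  have h1 := key p q hp0 hp1 hq0 hq1
  have h2 := key (1 - p) (1 - q) (by linarith) (by linarith) (by linarith) (by linarith)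
  nlinarith [Real.sq_sqrt hp0, Real.sq_sqrt hq0, Real.sq_sqrt (sub_nonneg.2 hp1),
    Real.sq_sqrt (sub_nonneg.2 hq1)]

/-- Replaces the exponential of a bounded variable by an affine function, whose expectation is
explicit. The lost factor 1/2 is the one in the width supermartingales. -/
lemma exp_neg_le_one_sub_half {y : ℝ} (h0 : 0 ≤ y) (h1 : y ≤ 1) : Real.exp (-y) ≤ 1 - y / 2 := by
  have h2 : y + 1 ≤ Real.exp y := Real.add_one_le_exp _
  have h3 : Real.exp y * Real.exp (-y) = 1 := by rw [← Real.exp_add]; simp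
  nlinarith [Real.exp_pos (-y)]

end RealInequalities

/-! ### Norms and determinants of positive definite matrices -/

section MatrixNorm

variable {d : ℕ}

open Matrix

lemma matNorm_nonneg (S : Matrix (Fin d) (Fin d) ℝ) (z : Feat d) : 0 ≤ matNorm S z :=
  Real.sqrt_nonneg _

lemma matNorm_neg (S : Matrix (Fin d) (Fin d) ℝ) (z : Feat d) : matNorm S (-z) = matNorm S z := by
  simp [matNorm, Matrix.mulVec_neg]

lemma matNorm_sq {S : Matrix (Fin d) (Fin d) ℝ} (hS : S.PosSemidef) (z : Feat d) :
    matNorm S z ^ 2 = z.ofLp ⬝ᵥ S *ᵥ z.ofLp :=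
  Real.sq_sqrt (by simpa using hS.dotProduct_mulVec_nonneg z.ofLp)

lemma dotProduct_mulVec_comm {S : Matrix (Fin d) (Fin d) ℝ} (hS : S.IsHermitian)
    (u v : Fin d → ℝ) : u ⬝ᵥ S *ᵥ v = v ⬝ᵥ S *ᵥ u := by
  rw [dotProduct_mulVec, ← mulVec_transpose, dotProduct_comm]
  congr 2

lemma inner_eq_dotProduct (u z : Feat d) : inner ℝ u z = u.ofLp ⬝ᵥ z.ofLp := by
  rw [EuclideanSpace.inner_eq_star_dotProduct, star_trivial, dotProduct_comm]

lemma norm_sq_eq_dotProduct (z : Feat d) : ‖z‖ ^ 2 = z.ofLp ⬝ᵥ z.ofLp := by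
  rw [← inner_eq_dotProduct, real_inner_self_eq_norm_sq]

/-- The Cauchy-Schwarz inequality for the dual norms of a positive definite matrix. -/
lemma abs_inner_le_matNorm_mul {S : Matrix (Fin d) (Fin d) ℝ} (hS : S.PosDef) (u z : Feat d) :
    |inner ℝ u z| ≤ matNorm S u * matNorm S⁻¹ z := by
  have hdet : IsUnit S.det := hS.det_pos.ne'.isUnit
  -- This is the squared S-norm of u − s S⁻¹z; its nonnegative discriminant condition is the claim.
  have hquad : ∀ s : ℝ, 0 ≤ matNorm S⁻¹ z ^ 2 * (s * s) + (-2 * inner ℝ u z) * s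
      + matNorm S u ^ 2 := by
    intro s
    have h := hS.posSemidef.dotProduct_mulVec_nonneg (u.ofLp - s • S⁻¹ *ᵥ z.ofLp)
    have h1 : S *ᵥ (S⁻¹ *ᵥ z.ofLp) = z.ofLp := by
      rw [mulVec_mulVec, mul_nonsing_inv _ hdet, one_mulVec]
    have h2 : S⁻¹ *ᵥ z.ofLp ⬝ᵥ S *ᵥ u.ofLp = u.ofLp ⬝ᵥ z.ofLp := by
      rw [dotProduct_mulVec_comm hS.isHermitian, h1]
    rw [star_trivial, mulVec_sub, mulVec_smul, h1, sub_dotProduct, dotProduct_sub,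
      dotProduct_sub, smul_dotProduct, smul_dotProduct, h2, dotProduct_smul, dotProduct_smul,
      dotProduct_comm (S⁻¹ *ᵥ z.ofLp)] at h
    rw [matNorm_sq hS.posSemidef, matNorm_sq hS.inv.posSemidef, inner_eq_dotProduct]
    simp only [smul_eq_mul] at h
    linarith
  have hd := discrim_le_zero hquad
  rw [discrim] at hd
  refine abs_le_of_sq_le_sq ?_ (mul_nonneg (matNorm_nonneg _ _) (matNorm_nonneg _ _))
  nlinarith

lemma matNorm_inv_sq_le {S : Matrix (Fin d) (Fin d) ℝ} (hS : S.PosDef) {lam : ℝ} (hlam : 0 < lam)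
    (h : ∀ z : Feat d, lam * ‖z‖ ^ 2 ≤ matNorm S z ^ 2) (z : Feat d) :
    matNorm S⁻¹ z ^ 2 ≤ ‖z‖ ^ 2 / lam := by
  have hdet : IsUnit S.det := hS.det_pos.ne'.isUnit
  set w : Feat d := WithLp.toLp 2 (S⁻¹ *ᵥ z.ofLp) with hw
  have h1 : S *ᵥ w.ofLp = z.ofLp := by
    simp [hw, mulVec_mulVec, mul_nonsing_inv _ hdet]
  have hq : matNorm S⁻¹ z ^ 2 = inner ℝ z w := by
    rw [matNorm_sq hS.inv.posSemidef, inner_eq_dotProduct]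
  have hq2 : matNorm S w ^ 2 = inner ℝ z w := by
    rw [matNorm_sq hS.posSemidef, h1, inner_eq_dotProduct, dotProduct_comm]
  have h3 := h w
  have h4 := real_inner_le_norm z w
  rw [hq2] at h3
  rw [hq, le_div_iff₀ hlam]
  rcases (norm_nonneg w).eq_or_lt with h0 | h0
  · rw [← h0] at h4
    nlinarith [sq_nonneg ‖z‖]
  · have : lam * ‖w‖ ≤ ‖z‖ := by nlinarith
    nlinarith [norm_nonneg z]

/-- AM-GM for the eigenvalues, in the form of the tangent line of log at c. -/
lemma log_det_le {S : Matrix (Fin d) (Fin d) ℝ} (hS : S.PosDef) {c : ℝ} (hc : 0 < c)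
    (htr : S.trace ≤ d * c) : Real.log S.det ≤ d * Real.log c := by
  have hpos := hS.eigenvalues_pos
  have hdet : S.det = ∏ i, hS.isHermitian.eigenvalues i := by
    simpa using hS.isHermitian.det_eq_prod_eigenvalues
  have htr' : S.trace = ∑ i, hS.isHermitian.eigenvalues i := by
    simpa using hS.isHermitian.trace_eq_sum_eigenvalues
  rw [hdet, Real.log_prod (fun i _ => (hpos i).ne')]
  have : ∀ i, Real.log (hS.isHermitian.eigenvalues i) ≤
      hS.isHermitian.eigenvalues i / c - 1 + Real.log c := by
    intro i
    have := Real.log_le_sub_one_of_pos (div_pos (hpos i) hc)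
    rw [Real.log_div (hpos i).ne' hc.ne'] at this
    linarith
  refine (Finset.sum_le_sum fun i _ => this i).trans ?_
  rw [Finset.sum_add_distrib, Finset.sum_sub_distrib, ← Finset.sum_div, ← htr']
  simp only [Finset.sum_const, Finset.card_univ, Fintype.card_fin, nsmul_eq_mul, mul_one]
  have : S.trace / c ≤ d := by rwa [div_le_iff₀ hc]
  linarith

lemma det_add_vecMulVec_self {S : Matrix (Fin d) (Fin d) ℝ} (hS : S.PosDef) (z : Feat d) :
    (S + vecMulVec z.ofLp z.ofLp).det = S.det * (1 + matNorm S⁻¹ z ^ 2) := by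
  rw [vecMulVec_eq Unit, det_add_replicateCol_mul_replicateRow hS.det_pos.ne'.isUnit,
    matNorm_sq hS.inv.posSemidef]
  congr 1
  rw [dotProduct_mulVec]
  simp [det_unique, mul_apply, dotProduct, vecMul]

end MatrixNorm

/-! ### The covariance matrix and the elliptical potential -/

section Covariance

open Matrix

variable {X A : Type*} [MeasurableSpace X] [MeasurableSpace A] {d : ℕ}

namespace Model

/-- The feature difference `φ(x,a¹) - φ(x,a²)` of a round. -/
noncomputable def featDiff (M : Model X A d) (z : Round X A) : Feat d :=
  M.φ z.1 z.2.1 - M.φ z.1 z.2.2.1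

/-- The elliptical potential `‖φ(x,a¹) - φ(x,a²)‖²_{Σ_D⁻¹}` of a round. -/
noncomputable def gain (M : Model X A d) (lam : ℝ) {t : ℕ} (D : Fin t → Round X A)
    (z : Round X A) : ℝ :=
  matNorm (M.cov lam D)⁻¹ (M.featDiff z) ^ 2

lemma cov_succ (M : Model X A d) (lam : ℝ) {t : ℕ} (D : Fin (t + 1) → Round X A) :
    M.cov lam D = M.cov lam (fun i : Fin t => D i.castSucc) +
      vecMulVec (M.featDiff (D (Fin.last t))).ofLp (M.featDiff (D (Fin.last t))).ofLp := by
  rw [cov, cov, Fin.sum_univ_castSucc, add_assoc]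
  rfl

lemma dotProduct_cov (M : Model X A d) (lam : ℝ) {t : ℕ} (D : Fin t → Round X A) (z : Feat d) :
    z.ofLp ⬝ᵥ M.cov lam D *ᵥ z.ofLp = lam * ‖z‖ ^ 2 + ∑ i, inner ℝ z (M.featDiff (D i)) ^ 2 := by
  rw [cov, add_mulVec, dotProduct_add, smul_mulVec, one_mulVec, dotProduct_smul,
    norm_sq_eq_dotProduct, smul_eq_mul, sum_mulVec, dotProduct_sum]
  congr 1
  refine Finset.sum_congr rfl fun i _ => ?_
  rw [vecMulVec_mulVec, inner_eq_dotProduct, featDiff]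
  rw [dotProduct_smul, dotProduct_comm _ z.ofLp, op_smul_eq_smul, smul_eq_mul, sq]

lemma cov_posDef (M : Model X A d) {lam : ℝ} (hlam : 0 < lam) {t : ℕ} (D : Fin t → Round X A) :
    (M.cov lam D).PosDef := by
  refine (Matrix.PosDef.one.smul hlam).add_posSemidef ?_
  refine Matrix.posSemidef_sum _ fun i _ => ?_
  simpa using Matrix.posSemidef_vecMulVec_self_star
    (M.φ (D i).1 (D i).2.1 - M.φ (D i).1 (D i).2.2.1).ofLp

lemma matNorm_cov_sq (M : Model X A d) {lam : ℝ} (hlam : 0 < lam) {t : ℕ}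
    (D : Fin t → Round X A) (z : Feat d) :
    matNorm (M.cov lam D) z ^ 2 = lam * ‖z‖ ^ 2 + ∑ i, inner ℝ z (M.featDiff (D i)) ^ 2 := by
  rw [matNorm_sq (M.cov_posDef hlam D).posSemidef, dotProduct_cov]

lemma matNorm_cov_inv_sq_le (M : Model X A d) {lam : ℝ} (hlam : 0 < lam) {t : ℕ}
    (D : Fin t → Round X A) (z : Feat d) :
    matNorm (M.cov lam D)⁻¹ z ^ 2 ≤ ‖z‖ ^ 2 / lam := by
  refine matNorm_inv_sq_le (M.cov_posDef hlam D) hlam (fun z => ?_) z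
  rw [M.matNorm_cov_sq hlam]
  linarith [Finset.sum_nonneg fun i (_ : i ∈ Finset.univ) =>
    sq_nonneg (inner ℝ z (M.featDiff (D i)))]

variable {M : Model X A d}

lemma norm_featDiff_le (hφ : ∀ x a, ‖M.φ x a‖ ≤ 1) (z : Round X A) : ‖M.featDiff z‖ ≤ 2 :=
  (norm_sub_le _ _).trans (by linarith [hφ z.1 z.2.1, hφ z.1 z.2.2.1])

lemma gain_nonneg (M : Model X A d) (lam : ℝ) {t : ℕ} (D : Fin t → Round X A) (z : Round X A) :
    0 ≤ M.gain lam D z := sq_nonneg _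

lemma gain_le (hφ : ∀ x a, ‖M.φ x a‖ ≤ 1) {lam : ℝ} (hlam : 0 < lam) {t : ℕ}
    (D : Fin t → Round X A) (z : Round X A) : M.gain lam D z ≤ 4 / lam := by
  refine (M.matNorm_cov_inv_sq_le hlam D _).trans ?_
  gcongr
  nlinarith [norm_featDiff_le hφ z, norm_nonneg (M.featDiff z)]

lemma trace_cov_le (hφ : ∀ x a, ‖M.φ x a‖ ≤ 1) (lam : ℝ) {t : ℕ} (D : Fin t → Round X A) :
    (M.cov lam D).trace ≤ d * lam + 4 * t := by
  rw [cov, trace_add, trace_smul, trace_one, trace_sum]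
  have : ∀ i, (vecMulVec (M.φ (D i).1 (D i).2.1 - M.φ (D i).1 (D i).2.2.1).ofLp
      (M.φ (D i).1 (D i).2.1 - M.φ (D i).1 (D i).2.2.1).ofLp).trace ≤ 4 := by
    intro i
    rw [trace_vecMulVec, ← norm_sq_eq_dotProduct]
    have := norm_featDiff_le hφ (D i)
    rw [featDiff] at this
    nlinarith [norm_nonneg (M.φ (D i).1 (D i).2.1 - M.φ (D i).1 (D i).2.2.1)]
  have h2 := Finset.sum_le_sum fun i (_ : i ∈ Finset.univ) => this i
  simp only [Finset.sum_const, Finset.card_univ, Fintype.card_fin, nsmul_eq_mul] at h2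
  simp only [Fintype.card_fin, smul_eq_mul]
  linarith

/-- Each round is a rank-one update, so the matrix determinant lemma makes the log-determinants
telescope. -/
lemma sum_log_one_add_gain (M : Model X A d) {lam : ℝ} (hlam : 0 < lam) (z : ℕ → Round X A)
    (t : ℕ) :
    ∑ s ∈ Finset.range t, Real.log (1 + M.gain lam (fun i : Fin s => z i) (z s)) =
      Real.log (M.cov lam (fun i : Fin t => z i)).det - d * Real.log lam := by
  induction t with
  | zero => simp [cov]
  | succ t ih =>
    rw [Finset.sum_range_succ, ih, M.cov_succ lam (fun i : Fin (t + 1) => z i),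
      det_add_vecMulVec_self (M.cov_posDef hlam _),
      Real.log_mul (M.cov_posDef hlam _).det_pos.ne' (by positivity)]
    simp only [gain, Fin.val_castSucc, Fin.val_last]
    ring

/-- The elliptical potential lemma. -/
lemma sum_gain_le (hφ : ∀ x a, ‖M.φ x a‖ ≤ 1) (hd : 0 < d) {lam : ℝ} (hlam : 0 < lam)
    (z : ℕ → Round X A) (t : ℕ) :
    ∑ s ∈ Finset.range t, M.gain lam (fun i : Fin s => z i) (z s) ≤
      (1 + 4 / lam) * (4 * (d * Real.log (1 + t / (d * lam)))) := by
  have hd' : (0 : ℝ) < d := by exact_mod_cast hd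
  -- λ may be small, so gains need not be below 1; g ≤ (1 + g) log(1 + g) works without truncation,
  -- at the price of the factor 1 + 4/λ.
  have h1 : ∀ s, M.gain lam (fun i : Fin s => z i) (z s) ≤
      (1 + 4 / lam) * Real.log (1 + M.gain lam (fun i : Fin s => z i) (z s)) := by
    intro s
    set g := M.gain lam (fun i : Fin s => z i) (z s)
    have hg0 : 0 ≤ g := gain_nonneg _ _ _ _
    have hg : g ≤ 4 / lam := gain_le hφ hlam _ _
    have h2 : 1 - (1 + g)⁻¹ ≤ Real.log (1 + g) :=
      Real.one_sub_inv_le_log_of_pos (by positivity)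
    have h3 : g = (1 + g) * (1 - (1 + g)⁻¹) := by field_simp; ring
    have h4 : 0 ≤ Real.log (1 + g) := Real.log_nonneg (by linarith)
    calc g = (1 + g) * (1 - (1 + g)⁻¹) := h3
      _ ≤ (1 + g) * Real.log (1 + g) := by gcongr
      _ ≤ _ := by gcongr
  refine (Finset.sum_le_sum fun s _ => h1 s).trans ?_
  rw [← Finset.mul_sum, M.sum_log_one_add_gain hlam]
  gcongr
  have hc : 0 < lam + 4 * t / d := by positivity
  have h2 := log_det_le (M.cov_posDef hlam (fun i : Fin t => z i)) hc (by
    refine (trace_cov_le hφ lam _).trans (le_of_eq ?_)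
    field_simp)
  have h3 : lam + 4 * t / d = lam * (1 + 4 * (t / (d * lam))) := by field_simp
  rw [h3, Real.log_mul hlam.ne' (by positivity)] at h2
  -- Bernoulli's inequality, 1 + 4u ≤ (1 + u)⁴, absorbs the bound 4 on squared feature differences.
  have h4 : Real.log (1 + 4 * (t / (d * lam))) ≤ 4 * Real.log (1 + t / (d * lam)) := by
    set u : ℝ := t / (d * lam)
    have hu : 0 ≤ u := by positivity
    have := one_add_mul_le_pow (a := u) (by linarith) 4
    have h5 := Real.log_le_log (by positivity) this
    rw [Real.log_pow] at h5
    exact_mod_cast h5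
  nlinarith

end Model

end Covariance

/-! ### Gibbs policies and the regret decomposition -/

section

variable {X A : Type*} [MeasurableSpace X] [MeasurableSpace A] {d : ℕ}

namespace Model

/-- The log-partition function of the Gibbs policy with parameter `θ`. -/
noncomputable def logPartition (M : Model X A d) (θ : Feat d) (x : X) : ℝ :=
  Real.log (∫ a, Real.exp (M.reward θ x a / M.η) ∂(M.π₀ x))

lemma expKL_nonneg (M : Model X A d) (π π' : Policy X A) : 0 ≤ M.expKL π π' :=
  integral_nonneg fun _ => ENNReal.toReal_nonneg

variable {M : Model X A d}

lemma gibbs_mem {θ : Feat d} (hθ : ‖θ‖ ≤ M.B) : M.gibbs θ ∈ M.policyClass :=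
  ⟨θ, by simpa using hθ, rfl⟩

namespace LinearAssumption

variable (hM : M.LinearAssumption)

include hM

lemma abs_reward_le (θ : Feat d) (x : X) (a : A) : |M.reward θ x a| ≤ ‖θ‖ :=
  (abs_real_inner_le_norm _ _).trans (mul_le_of_le_one_right (norm_nonneg _) (hM.norm_φ_le x a))

lemma measurable_reward (θ : Feat d) : Measurable (Function.uncurry (M.reward θ)) :=
  Measurable.inner (𝕜 := ℝ) measurable_const hM.measurable_φ

lemma integrable_exp_reward (θ : Feat d) (x : X) :
    Integrable (fun a => Real.exp (M.reward θ x a / M.η)) (M.π₀ x) := by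
  have := hM.markov_π₀
  refine Integrable.of_bound (C := Real.exp (‖θ‖ / M.η)) ?_ (ae_of_all _ fun a => ?_)
  · exact (((hM.measurable_reward θ).of_uncurry_left (x := x)).div_const _).exp.aestronglyMeasurable
  · rw [Real.norm_eq_abs, Real.abs_exp]
    have := hM.η_pos
    gcongr
    exact (le_abs_self _).trans (hM.abs_reward_le θ x a)

lemma isProbabilityMeasure_gibbs (θ : Feat d) (x : X) : IsProbabilityMeasure (M.gibbs θ x) := by
  have := hM.markov_π₀
  exact isProbabilityMeasure_tilted (hM.integrable_exp_reward θ x)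

lemma isProbabilityMeasure_of_mem {π : Policy X A} (hπ : π ∈ M.policyClass) (x : X) :
    IsProbabilityMeasure (π x) := by
  obtain ⟨θ, -, rfl⟩ := hπ
  exact hM.isProbabilityMeasure_gibbs θ x

lemma integrable_φ (x : X) (μ : Measure A) [IsFiniteMeasure μ] : Integrable (M.φ x) μ :=
  Integrable.of_bound (hM.measurable_φ.of_uncurry_left (x := x)).aestronglyMeasurable 1
    (ae_of_all _ (hM.norm_φ_le x))

lemma norm_meanφ_le {x : X} {π : Policy X A} [IsProbabilityMeasure (π x)] :
    ‖M.meanφ x π‖ ≤ 1 := by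
  refine (norm_integral_le_of_norm_le_const (C := 1) (ae_of_all _ (hM.norm_φ_le x))).trans ?_
  simp

lemma integral_reward (θ : Feat d) (x : X) (π : Policy X A) [IsFiniteMeasure (π x)] :
    ∫ a, M.reward θ x a ∂(π x) = inner ℝ θ (M.meanφ x π) :=
  integral_inner (hM.integrable_φ x _) θ

lemma gibbs_zero : M.gibbs 0 = M.π₀ := by
  have := hM.markov_π₀
  funext x
  simp [gibbs, reward]

lemma integral_exp_reward_pos (θ : Feat d) (x : X) :
    0 < ∫ a, Real.exp (M.reward θ x a / M.η) ∂(M.π₀ x) := by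
  have := hM.markov_π₀
  exact integral_exp_pos (hM.integrable_exp_reward θ x)

lemma absolutelyContinuous_gibbs (θ θ' : Feat d) (x : X) : M.gibbs θ' x ≪ M.gibbs θ x := by
  have := hM.markov_π₀
  exact (tilted_absolutelyContinuous _ _).trans
    (absolutelyContinuous_tilted (hM.integrable_exp_reward θ x))

/-- One Gibbs policy is an exponential tilt of another, by the reward of the parameter difference.
All KL computations below reduce to this affine log-density. -/
lemma llr_gibbs (θ θ' : Feat d) (x : X) :
    llr (M.gibbs θ' x) (M.gibbs θ x) =ᵐ[M.gibbs θ' x]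
      fun a => M.reward (θ' - θ) x a / M.η - (M.logPartition θ' x - M.logPartition θ x) := by
  have := hM.markov_π₀
  have h1 := hM.isProbabilityMeasure_gibbs θ x
  have h2 := hM.isProbabilityMeasure_gibbs θ' x
  set f := fun a => M.reward θ x a / M.η with hf
  set g := fun a => M.reward (θ' - θ) x a / M.η with hg
  have hfg : f + g = fun a => M.reward θ' x a / M.η := by
    funext a
    simp only [hf, hg, Pi.add_apply, reward, inner_sub_left]
    ring
  have htilt : M.gibbs θ' x = (M.gibbs θ x).tilted g := by
    rw [gibbs, gibbs, tilted_tilted (hM.integrable_exp_reward θ x), hfg]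
  have hexp : Integrable (fun a => Real.exp (g a)) (M.gibbs θ x) := by
    refine Integrable.of_bound (C := Real.exp (‖θ' - θ‖ / M.η)) ?_ (ae_of_all _ fun a => ?_)
    · exact (((hM.measurable_reward (θ' - θ)).of_uncurry_left (x := x)).div_const
        _).exp.aestronglyMeasurable
    · rw [Real.norm_eq_abs, Real.abs_exp]
      have := hM.η_pos
      simp only [hg]
      gcongr
      exact (le_abs_self _).trans (hM.abs_reward_le _ x a)
  have hZ : Real.log (∫ a, Real.exp (g a) ∂(M.gibbs θ x)) =
      M.logPartition θ' x - M.logPartition θ x := by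
    rw [gibbs, integral_exp_tilted, hfg, Real.log_div (hM.integral_exp_reward_pos θ' x).ne'
      (hM.integral_exp_reward_pos θ x).ne', logPartition, logPartition]
  refine (hM.absolutelyContinuous_gibbs θ θ' x).ae_eq ?_
  rw [htilt, ← hZ]
  exact log_rnDeriv_tilted_left_self hexp

lemma integrable_reward (θ : Feat d) (x : X) (μ : Measure A) [IsFiniteMeasure μ] :
    Integrable (M.reward θ x) μ :=
  (hM.integrable_φ x μ).const_inner θ

lemma klDiv_gibbs_ne_top (θ θ' : Feat d) (x : X) :
    InformationTheory.klDiv (M.gibbs θ' x) (M.gibbs θ x) ≠ ∞ := by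
  have := hM.isProbabilityMeasure_gibbs θ' x
  refine InformationTheory.klDiv_ne_top (hM.absolutelyContinuous_gibbs θ θ' x) ?_
  rw [integrable_congr (hM.llr_gibbs θ θ' x)]
  exact ((hM.integrable_reward _ x _).div_const _).sub (integrable_const _)

lemma toReal_klDiv_gibbs (θ θ' : Feat d) (x : X) :
    (InformationTheory.klDiv (M.gibbs θ' x) (M.gibbs θ x)).toReal =
      inner ℝ (θ' - θ) (M.meanφ x (M.gibbs θ')) / M.η
        - (M.logPartition θ' x - M.logPartition θ x) := by
  have h1 := hM.isProbabilityMeasure_gibbs θ x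
  have h2 := hM.isProbabilityMeasure_gibbs θ' x
  rw [InformationTheory.toReal_klDiv_of_measure_eq (hM.absolutelyContinuous_gibbs θ θ' x)
    (by simp), integral_congr_ae (hM.llr_gibbs θ θ' x),
    integral_sub ((hM.integrable_reward _ x _).div_const _) (integrable_const _), integral_const,
    integral_div, hM.integral_reward]
  simp

lemma measurable_logPartition (θ : Feat d) : Measurable (M.logPartition θ) := by
  have := hM.markov_π₀
  refine Real.measurable_log.comp ?_
  exact (StronglyMeasurable.integral_kernel_prod_right' (κ := M.π₀)
    (f := fun p : X × A => Real.exp (M.reward θ p.1 p.2 / M.η))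
    (((hM.measurable_reward θ).div_const _).exp.stronglyMeasurable)).measurable

lemma stronglyMeasurable_meanφ_gibbs (θ : Feat d) :
    StronglyMeasurable fun x => M.meanφ x (M.gibbs θ) := by
  have := hM.markov_π₀
  simp only [meanφ, gibbs, integral_tilted, div_eq_inv_mul, mul_smul, integral_smul]
  refine StronglyMeasurable.smul (𝕜 := ℝ) ?_ ?_
  · exact (StronglyMeasurable.integral_kernel_prod_right' (κ := M.π₀)
      (f := fun p : X × A => Real.exp (M.η⁻¹ * M.reward θ p.1 p.2))
      (((hM.measurable_reward θ).const_mul _).exp.stronglyMeasurable)).measurable.inv.stronglyMeasurable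
  · exact (StronglyMeasurable.integral_kernel_prod_right' (κ := M.π₀)
      (f := fun p : X × A => Real.exp (M.η⁻¹ * M.reward θ p.1 p.2) • M.φ p.1 p.2)
      (((hM.measurable_reward θ).const_mul _).exp.smul hM.measurable_φ).stronglyMeasurable)

lemma abs_logPartition_le (θ : Feat d) (x : X) : |M.logPartition θ x| ≤ ‖θ‖ / M.η := by
  have := hM.markov_π₀
  have hη := hM.η_pos
  have hb : ∀ a, |M.reward θ x a / M.η| ≤ ‖θ‖ / M.η := fun a => by
    rw [abs_div, abs_of_pos hη]
    gcongr
    exact hM.abs_reward_le θ x a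
  have hlow : Real.exp (-(‖θ‖ / M.η)) ≤ ∫ a, Real.exp (M.reward θ x a / M.η) ∂(M.π₀ x) := by
    have := integral_mono (μ := M.π₀ x) (integrable_const (Real.exp (-(‖θ‖ / M.η))))
      (hM.integrable_exp_reward θ x) fun a => Real.exp_le_exp.2 (abs_le.1 (hb a)).1
    simpa using this
  have hup : ∫ a, Real.exp (M.reward θ x a / M.η) ∂(M.π₀ x) ≤ Real.exp (‖θ‖ / M.η) := by
    have := integral_mono (μ := M.π₀ x) (hM.integrable_exp_reward θ x)
      (integrable_const (Real.exp (‖θ‖ / M.η))) fun a => Real.exp_le_exp.2 (abs_le.1 (hb a)).2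
    simpa using this
  rw [logPartition, abs_le]
  constructor
  · rw [Real.le_log_iff_exp_le (hM.integral_exp_reward_pos θ x)]
    exact hlow
  · rwa [Real.log_le_iff_le_exp (hM.integral_exp_reward_pos θ x)]

lemma integrable_logPartition (θ : Feat d) : Integrable (M.logPartition θ) M.d₀ := by
  have := hM.prob_d₀
  exact Integrable.of_bound (hM.measurable_logPartition θ).aestronglyMeasurable (‖θ‖ / M.η)
    (ae_of_all _ fun x => hM.abs_logPartition_le θ x)

lemma integrable_meanφ {π : Policy X A} (hπ : π ∈ M.policyClass) :
    Integrable (fun x => M.meanφ x π) M.d₀ := by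
  have := hM.prob_d₀
  obtain ⟨θ, -, rfl⟩ := hπ
  refine Integrable.of_bound (hM.stronglyMeasurable_meanφ_gibbs θ).aestronglyMeasurable 1
    (ae_of_all _ fun x => ?_)
  have := hM.isProbabilityMeasure_gibbs θ x
  exact hM.norm_meanφ_le

lemma logPartition_zero (x : X) : M.logPartition 0 x = 0 := by
  have := hM.markov_π₀
  simp [logPartition, reward]

lemma integrand_value_gibbs (θ θ' : Feat d) (x : X) :
    (∫ a, M.reward θ x a ∂(M.gibbs θ' x))
        - M.η * (InformationTheory.klDiv (M.gibbs θ' x) (M.π₀ x)).toReal =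
      inner ℝ (θ - θ') (M.meanφ x (M.gibbs θ')) + M.η * M.logPartition θ' x := by
  have := hM.isProbabilityMeasure_gibbs θ' x
  have hη := hM.η_pos.ne'
  rw [hM.integral_reward, ← hM.gibbs_zero, hM.toReal_klDiv_gibbs, sub_zero,
    hM.logPartition_zero, sub_zero, inner_sub_left]
  field_simp
  ring

lemma integrable_integrand_value (θ : Feat d) {π : Policy X A} (hπ : π ∈ M.policyClass) :
    Integrable (fun x => (∫ a, M.reward θ x a ∂(π x))
      - M.η * (InformationTheory.klDiv (π x) (M.π₀ x)).toReal) M.d₀ := by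
  obtain ⟨θ', hθ', rfl⟩ := hπ
  simp only [hM.integrand_value_gibbs]
  exact ((hM.integrable_meanφ ⟨θ', hθ', rfl⟩).const_inner _).add
    ((hM.integrable_logPartition θ').const_mul _)

lemma value_sub_value (θ₁ θ₂ : Feat d) {π : Policy X A} (hπ : π ∈ M.policyClass) :
    M.value (M.reward θ₁) π - M.value (M.reward θ₂) π =
      ∫ x, inner ℝ (θ₁ - θ₂) (M.meanφ x π) ∂M.d₀ := by
  rw [value, value, ← integral_sub (hM.integrable_integrand_value θ₁ hπ)
    (hM.integrable_integrand_value θ₂ hπ)]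
  congr 1
  funext x
  have := hM.isProbabilityMeasure_of_mem hπ x
  rw [hM.integral_reward, hM.integral_reward, inner_sub_left]
  ring

/-- The Gibbs variational identity: the value gap is exactly a KL divergence, which yields both
optimality and uniqueness up to null sets of prompts. -/
lemma value_gibbs_sub {θ : Feat d} (hθ : ‖θ‖ ≤ M.B) {π : Policy X A} (hπ : π ∈ M.policyClass) :
    M.value (M.reward θ) (M.gibbs θ) - M.value (M.reward θ) π =
      M.η * M.expKL π (M.gibbs θ) := by
  rw [value, value, ← integral_sub (hM.integrable_integrand_value θ (gibbs_mem hθ))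
    (hM.integrable_integrand_value θ hπ), expKL, ← integral_const_mul]
  obtain ⟨θ', -, rfl⟩ := hπ
  congr 1
  funext x
  have hη := hM.η_pos.ne'
  rw [hM.integrand_value_gibbs, hM.integrand_value_gibbs, hM.toReal_klDiv_gibbs,
    sub_self, inner_zero_left, inner_sub_left, inner_sub_left]
  field_simp
  ring

lemma integrable_toReal_klDiv {π π' : Policy X A} (hπ : π ∈ M.policyClass)
    (hπ' : π' ∈ M.policyClass) :
    Integrable (fun x => (InformationTheory.klDiv (π x) (π' x)).toReal) M.d₀ := by
  obtain ⟨θ, hθ, rfl⟩ := hπ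
  obtain ⟨θ', -, rfl⟩ := hπ'
  simp only [hM.toReal_klDiv_gibbs]
  exact (((hM.integrable_meanφ ⟨θ, hθ, rfl⟩).const_inner _).div_const _).sub
    ((hM.integrable_logPartition θ).sub (hM.integrable_logPartition θ'))

/-- Every maximizer over the policy class of the regularized value for `r_θ` is almost everywhere
the Gibbs policy `π_θ`. -/
lemma ae_eq_gibbs_of_isMaxOn {θ : Feat d} (hθ : ‖θ‖ ≤ M.B) {π : Policy X A}
    (hπ : π ∈ M.policyClass) (hmax : IsMaxOn (M.value (M.reward θ)) M.policyClass π) :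
    ∀ᵐ x ∂M.d₀, π x = M.gibbs θ x := by
  have h1 := hM.value_gibbs_sub hθ hπ
  have h2 : M.value (M.reward θ) (M.gibbs θ) ≤ M.value (M.reward θ) π := hmax (gibbs_mem hθ)
  have h3 : M.expKL π (M.gibbs θ) = 0 := by
    have := M.expKL_nonneg π (M.gibbs θ)
    have := hM.η_pos
    by_contra h
    have : 0 < M.η * M.expKL π (M.gibbs θ) := by positivity
    linarith
  rw [expKL, integral_eq_zero_iff_of_nonneg (fun _ => ENNReal.toReal_nonneg)
    (hM.integrable_toReal_klDiv hπ (gibbs_mem hθ))] at h3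
  filter_upwards [h3] with x hx
  obtain ⟨θ', -, rfl⟩ := hπ
  have := hM.isProbabilityMeasure_gibbs θ x
  have := hM.isProbabilityMeasure_gibbs θ' x
  exact InformationTheory.klDiv_eq_zero_iff.1
    (((ENNReal.toReal_eq_zero_iff _).1 hx).resolve_right (hM.klDiv_gibbs_ne_top θ θ' x))

lemma value_sub_of_isMaxOn {θ : Feat d} (hθ : ‖θ‖ ≤ M.B) {π₁ π : Policy X A}
    (hπ₁ : π₁ ∈ M.policyClass) (hmax : IsMaxOn (M.value (M.reward θ)) M.policyClass π₁)
    (hπ : π ∈ M.policyClass) :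
    M.value (M.reward θ) π₁ - M.value (M.reward θ) π = M.η * M.expKL π π₁ := by
  have hae := hM.ae_eq_gibbs_of_isMaxOn hθ hπ₁ hmax
  have h1 : M.value (M.reward θ) π₁ = M.value (M.reward θ) (M.gibbs θ) :=
    integral_congr_ae (by filter_upwards [hae] with x hx; rw [hx])
  have h2 : M.expKL π π₁ = M.expKL π (M.gibbs θ) :=
    integral_congr_ae (by filter_upwards [hae] with x hx; rw [hx])
  rw [h1, h2, hM.value_gibbs_sub hθ hπ]

/-- The regret decomposition for a policy `π₁` that is optimal for the reward `r_θ`. -/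
lemma value_sub_value_eq {θ θStar : Feat d} (hθ : ‖θ‖ ≤ M.B) {π₁ π : Policy X A}
    (hπ₁ : π₁ ∈ M.policyClass) (hmax : IsMaxOn (M.value (M.reward θ)) M.policyClass π₁)
    (hπ : π ∈ M.policyClass) :
    M.value (M.reward θStar) π - M.value (M.reward θStar) π₁ =
      ∫ x, inner ℝ (θStar - θ) (M.meanφ x π - M.meanφ x π₁) ∂M.d₀ - M.η * M.expKL π π₁ := by
  rw [← hM.value_sub_of_isMaxOn hθ hπ₁ hmax hπ]
  simp only [inner_sub_right]
  rw [integral_sub ((hM.integrable_meanφ hπ).const_inner _)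
    ((hM.integrable_meanφ hπ₁).const_inner _), ← hM.value_sub_value _ _ hπ,
    ← hM.value_sub_value _ _ hπ₁]
  ring

end LinearAssumption

end Model

end

/-! ### Supermartingales along a run -/

section

variable {X A : Type*} [MeasurableSpace X] [MeasurableSpace A] {d : ℕ}
  {M : Model X A d} {lam β : ℝ}

namespace Model.OptionII

/-- The conditional expectation of a function of the next round given the data `D`. -/
noncomputable def stepLIntegral (alg : M.OptionII lam β) (t : ℕ) (D : Fin t → Round X A)
    (g : Round X A → ℝ≥0∞) : ℝ≥0∞ :=
  ∫⁻ x, ∫⁻ a₁, ∫⁻ a₂,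
    (ENNReal.ofReal (Real.sigmoid (M.rStar x a₁ - M.rStar x a₂)) * g (x, a₁, a₂, true) +
      ENNReal.ofReal (Real.sigmoid (M.rStar x a₂ - M.rStar x a₁)) * g (x, a₁, a₂, false))
    ∂(alg.enhancer t (D, x, x)) ∂(alg.main t (D, x)) ∂M.d₀

lemma stepLIntegral_const_mul (alg : M.OptionII lam β) (t : ℕ) (D : Fin t → Round X A)
    (g : Round X A → ℝ≥0∞) {c : ℝ≥0∞} (hc : c ≠ ∞) :
    alg.stepLIntegral t D (fun z => c * g z) = c * alg.stepLIntegral t D g := by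
  simp only [stepLIntegral, mul_left_comm _ c, ← mul_add, lintegral_const_mul' c _ hc]

lemma isProbabilityMeasure_main (alg : M.OptionII lam β) (hM : M.LinearAssumption) (t : ℕ)
    (p : (Fin t → Round X A) × X) : IsProbabilityMeasure (alg.main t p) :=
  hM.isProbabilityMeasure_of_mem (alg.main_mem t p.1) p.2

lemma isProbabilityMeasure_enhancer (alg : M.OptionII lam β) (hM : M.LinearAssumption) (t : ℕ)
    (p : (Fin t → Round X A) × X × X) : IsProbabilityMeasure (alg.enhancer t p) :=
  hM.isProbabilityMeasure_of_mem (alg.enhancer_mem t p.1 p.2.1).1 p.2.2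

lemma isMarkovKernel_main (alg : M.OptionII lam β) (hM : M.LinearAssumption) (t : ℕ) :
    IsMarkovKernel (alg.main t) := ⟨alg.isProbabilityMeasure_main hM t⟩

lemma isMarkovKernel_enhancer (alg : M.OptionII lam β) (hM : M.LinearAssumption) (t : ℕ) :
    IsMarkovKernel (alg.enhancer t) := ⟨alg.isProbabilityMeasure_enhancer hM t⟩

lemma stepLIntegral_le_of_label (alg : M.OptionII lam β) (hM : M.LinearAssumption) (t : ℕ)
    (D : Fin t → Round X A) {g : Round X A → ℝ≥0∞}
    (h : ∀ x a₁ a₂, ENNReal.ofReal (Real.sigmoid (M.rStar x a₁ - M.rStar x a₂)) *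
        g (x, a₁, a₂, true) + ENNReal.ofReal (Real.sigmoid (M.rStar x a₂ - M.rStar x a₁)) *
        g (x, a₁, a₂, false) ≤ 1) :
    alg.stepLIntegral t D g ≤ 1 := by
  have := hM.prob_d₀
  calc alg.stepLIntegral t D g
      ≤ ∫⁻ x, ∫⁻ a₁, ∫⁻ a₂, 1 ∂(alg.enhancer t (D, x, x)) ∂(alg.main t (D, x)) ∂M.d₀ :=
        lintegral_mono fun x => lintegral_mono fun a₁ => lintegral_mono fun a₂ => h x a₁ a₂
    _ = 1 := by
        have h1 := fun x => (alg.isProbabilityMeasure_enhancer hM t (D, x, x)).measure_univ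
        have h2 := fun x => (alg.isProbabilityMeasure_main hM t (D, x)).measure_univ
        simp [h1, h2]

/-- The two label probabilities sum to 1, so the label integrates out. -/
lemma stepLIntegral_of_forall_label (alg : M.OptionII lam β) (t : ℕ)
    (D : Fin t → Round X A) (g : X → A → A → ℝ≥0∞) :
    alg.stepLIntegral t D (fun z => g z.1 z.2.1 z.2.2.1) =
      ∫⁻ x, ∫⁻ a₁, ∫⁻ a₂, g x a₁ a₂ ∂(alg.enhancer t (D, x, x)) ∂(alg.main t (D, x)) ∂M.d₀ := by
  have h : ∀ u v : ℝ, ENNReal.ofReal (Real.sigmoid (u - v)) +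
      ENNReal.ofReal (Real.sigmoid (v - u)) = 1 := by
    intro u v
    rw [← ENNReal.ofReal_add (Real.sigmoid_nonneg _) (Real.sigmoid_nonneg _), ← neg_sub u v,
      Real.sigmoid_neg]
    simp
  simp only [stepLIntegral, ← add_mul, h, one_mul]

end Model.OptionII

section Supermartingale

variable {Ω : Type*} [MeasurableSpace Ω] {P : Measure Ω} {alg : M.OptionII lam β} {T : ℕ}
  {Z : ℕ → Ω → Round X A}

lemma IsRun.measurable_hist (hrun : IsRun alg P T Z) (t : ℕ) : Measurable (hist Z t) :=
  measurable_pi_lambda _ fun i => hrun.measurable i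

/-- The supermartingale property by induction, with the run law used in place of conditional
expectations. -/
lemma IsRun.lintegral_prod_le_one [IsProbabilityMeasure P] (hrun : IsRun alg P T Z)
    {f : ∀ s, (Fin s → Round X A) → Round X A → ℝ≥0∞}
    (hf : ∀ s, Measurable (Function.uncurry (f s))) (hfin : ∀ s D z, f s D z ≠ ∞)
    (hstep : ∀ s D, alg.stepLIntegral s D (f s D) ≤ 1) {t : ℕ} (ht : t ≤ T) :
    ∫⁻ ω, ∏ s ∈ Finset.range t, f s (hist Z s ω) (Z s ω) ∂P ≤ 1 := by
  induction t with
  | zero => simp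
  | succ t ih =>
    -- The past product as a function of the history alone, so that it is a constant factor inside
    -- the next step's integral.
    let C : (Fin t → Round X A) → ℝ≥0∞ := fun D =>
      ∏ s : Fin t, f s (fun i : Fin s => D ⟨i, i.2.trans s.2⟩) (D s)
    have hC : Measurable C := by
      refine Finset.measurable_prod _ fun s _ => ?_
      exact (hf s).comp (f := fun D : Fin t → Round X A =>
        ((fun i : Fin s => D ⟨i, i.2.trans s.2⟩), D s)) (by fun_prop)
    have hCfin : ∀ D, C D ≠ ∞ := fun D => ENNReal.prod_ne_top fun s _ => hfin _ _ _
    have hCω : ∀ ω, ∏ s ∈ Finset.range t, f s (hist Z s ω) (Z s ω) = C (hist Z t ω) := by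
      intro ω
      rw [Finset.prod_range]
      rfl
    have hF : Measurable (Function.uncurry fun D z => C D * f t D z) :=
      (hC.comp measurable_fst).mul (hf t)
    have hlaw := hrun.law t (by omega) (fun D z => C D * f t D z) hF
    calc ∫⁻ ω, ∏ s ∈ Finset.range (t + 1), f s (hist Z s ω) (Z s ω) ∂P
        = ∫⁻ ω, C (hist Z t ω) * f t (hist Z t ω) (Z t ω) ∂P := by
          simp only [Finset.prod_range_succ, hCω]
      _ = ∫⁻ ω, alg.stepLIntegral t (hist Z t ω)
            (fun z => C (hist Z t ω) * f t (hist Z t ω) z) ∂P := hlaw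
      _ ≤ ∫⁻ ω, C (hist Z t ω) ∂P := by
          refine lintegral_mono fun ω => ?_
          dsimp only
          rw [alg.stepLIntegral_const_mul _ _ _ (hCfin _)]
          exact mul_le_of_le_one_right' (hstep _ _)
      _ ≤ 1 := by
          simp only [← hCω]
          exact ih (by omega)

/-- The exponential-supermartingale deviation inequality along a run. -/
lemma IsRun.measure_log_le_sum [IsProbabilityMeasure P] (hrun : IsRun alg P T Z)
    {g : ∀ s, (Fin s → Round X A) → Round X A → ℝ}
    (hg : ∀ s, Measurable (Function.uncurry (g s)))
    (hstep : ∀ s D, alg.stepLIntegral s D (fun z => ENNReal.ofReal (Real.exp (g s D z))) ≤ 1)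
    {δ : ℝ} (hδ : 0 < δ) :
    P {ω | Real.log (1 / δ) ≤ ∑ s ∈ Finset.range T, g s (hist Z s ω) (Z s ω)} ≤
      ENNReal.ofReal δ := by
  have hmeas : ∀ s, Measurable fun ω => g s (hist Z s ω) (Z s ω) := fun s =>
    (hg s).comp ((hrun.measurable_hist s).prodMk (hrun.measurable s))
  have h1 := hrun.lintegral_prod_le_one
    (f := fun s D z => ENNReal.ofReal (Real.exp (g s D z)))
    (fun s => (hg s).exp.ennreal_ofReal) (fun _ _ _ => ENNReal.ofReal_ne_top) hstep le_rfl
  have h2 : ∀ ω, ∏ s ∈ Finset.range T, ENNReal.ofReal (Real.exp (g s (hist Z s ω) (Z s ω))) =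
      ENNReal.ofReal (Real.exp (∑ s ∈ Finset.range T, g s (hist Z s ω) (Z s ω))) := by
    intro ω
    rw [Real.exp_sum, ENNReal.ofReal_prod_of_nonneg fun _ _ => (Real.exp_pos _).le]
  simp only [h2] at h1
  have h3 := meas_ge_le_lintegral_div (μ := P)
    (f := fun ω => ENNReal.ofReal (Real.exp (∑ s ∈ Finset.range T, g s (hist Z s ω) (Z s ω))))
    (Finset.measurable_sum _ fun s _ => hmeas s).exp.ennreal_ofReal.aemeasurable
    (ε := ENNReal.ofReal (1 / δ)) (by simpa using hδ) ENNReal.ofReal_ne_top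
  calc _ ≤ _ := measure_mono fun ω hω => ?_
    _ ≤ _ := h3
    _ ≤ 1 / ENNReal.ofReal (1 / δ) := by gcongr
    _ = ENNReal.ofReal δ := by
      rw [one_div, one_div, ENNReal.ofReal_inv_of_pos hδ, inv_inv]
  simp only [Set.mem_ofPred_eq] at hω ⊢
  refine ENNReal.ofReal_le_ofReal ?_
  rwa [← Real.log_le_iff_le_exp (by positivity)]

end Supermartingale

/-! ### Measurability of potentials in the data -/

section Measurability

variable {Y : Type*} [MeasurableSpace Y]

lemma measurable_matrix_det {S : Y → Matrix (Fin d) (Fin d) ℝ}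
    (hS : ∀ i j, Measurable fun y => S y i j) : Measurable fun y => (S y).det := by
  simp only [Matrix.det_apply]
  refine Finset.measurable_sum _ fun σ _ => Measurable.const_smul ?_ _
  exact Finset.measurable_prod _ fun i _ => hS _ _

lemma measurable_matrix_inv {S : Y → Matrix (Fin d) (Fin d) ℝ}
    (hS : ∀ i j, Measurable fun y => S y i j) (i j : Fin d) :
    Measurable fun y => (S y)⁻¹ i j := by
  simp only [Matrix.inv_def, Matrix.smul_apply, Ring.inverse_eq_inv', smul_eq_mul,
    Matrix.adjugate_apply]
  refine (measurable_matrix_det hS).inv.mul (measurable_matrix_det fun k l => ?_)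
  simp only [Matrix.updateRow_apply]
  split_ifs
  · exact measurable_const
  · exact hS k l

lemma measurable_matNorm {S : Y → Matrix (Fin d) (Fin d) ℝ}
    (hS : ∀ i j, Measurable fun y => S y i j) {z : Y → Feat d} (hz : Measurable z) :
    Measurable fun y => matNorm (S y) (z y) := by
  have hz' : ∀ i, Measurable fun y => (z y).ofLp i := fun i => by fun_prop
  simp only [matNorm, dotProduct, Matrix.mulVec]
  refine Measurable.sqrt ?_
  exact Finset.measurable_sum _ fun i _ => (hz' i).mul
    (Finset.measurable_sum _ fun j _ => (hS i j).mul (hz' j))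

namespace Model.LinearAssumption

variable (hM : M.LinearAssumption)

include hM

lemma measurable_featDiff : Measurable M.featDiff :=
  (hM.measurable_φ.comp (f := fun z : Round X A => (z.1, z.2.1)) (by fun_prop)).sub
    (hM.measurable_φ.comp (f := fun z : Round X A => (z.1, z.2.2.1)) (by fun_prop))

lemma measurable_cov (lam : ℝ) {t : ℕ} (i j : Fin d) :
    Measurable fun D : Fin t → Round X A => M.cov lam D i j := by
  have h : ∀ k, Measurable fun D : Fin t → Round X A => M.featDiff (D k) := fun k =>
    hM.measurable_featDiff.comp (measurable_pi_apply k)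
  have h' : ∀ k i, Measurable fun D : Fin t → Round X A => (M.featDiff (D k)).ofLp i :=
    fun k i => by have := h k; fun_prop
  simp only [cov, Matrix.add_apply, Matrix.sum_apply, Matrix.vecMulVec_apply]
  exact measurable_const.add (Finset.measurable_sum _ fun k _ => (h' k i).mul (h' k j))

lemma measurable_gain (lam : ℝ) (t : ℕ) :
    Measurable (Function.uncurry fun (D : Fin t → Round X A) z => M.gain lam D z) := by
  refine Measurable.pow_const ?_ 2
  refine measurable_matNorm (measurable_matrix_inv fun i j => ?_) ?_
  · exact (hM.measurable_cov lam i j).comp measurable_fst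
  · exact hM.measurable_featDiff.comp measurable_snd

end Model.LinearAssumption

end Measurability

/-! ### Widths and their comparison with the potential -/

namespace Model.OptionII

/-- The feature gap between the enhancer and the main agent at the observed prompt `x`. -/
noncomputable def gap (alg : M.OptionII lam β) (t : ℕ) (D : Fin t → Round X A) (x : X) : Feat d :=
  M.meanφ x (fun x' => alg.enhancer t (D, x, x')) - M.meanφ x (fun x' => alg.main t (D, x'))

/-- The squared `Σ_D⁻¹`-norm of the feature gap. -/
noncomputable def width (alg : M.OptionII lam β) (t : ℕ) (D : Fin t → Round X A) (x : X) : ℝ :=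
  matNorm (M.cov lam D)⁻¹ (alg.gap t D x) ^ 2

variable (alg : M.OptionII lam β) (hM : M.LinearAssumption)

lemma width_nonneg (t : ℕ) (D : Fin t → Round X A) (x : X) : 0 ≤ alg.width t D x := sq_nonneg _

include hM

lemma norm_gap_le (t : ℕ) (D : Fin t → Round X A) (x : X) : ‖alg.gap t D x‖ ≤ 2 := by
  have h1 := alg.isProbabilityMeasure_main hM t (D, x)
  have h2 := alg.isProbabilityMeasure_enhancer hM t (D, x, x)
  have h3 := hM.norm_meanφ_le (x := x) (π := fun x' => alg.main t (D, x'))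
  have h4 := hM.norm_meanφ_le (x := x) (π := fun x' => alg.enhancer t (D, x, x'))
  exact (norm_sub_le _ _).trans (by linarith)

lemma width_le (hlam : 0 < lam) (t : ℕ) (D : Fin t → Round X A) (x : X) :
    alg.width t D x ≤ 4 / lam := by
  refine (M.matNorm_cov_inv_sq_le hlam D _).trans ?_
  gcongr
  nlinarith [alg.norm_gap_le hM t D x, norm_nonneg (alg.gap t D x)]

lemma measurable_width (t : ℕ) : Measurable (Function.uncurry (alg.width t)) := by
  have := alg.isMarkovKernel_main hM t
  have := alg.isMarkovKernel_enhancer hM t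
  refine Measurable.pow_const ?_ 2
  refine measurable_matNorm (measurable_matrix_inv fun i j => ?_) (Measurable.sub ?_ ?_)
  · exact (hM.measurable_cov lam i j).comp measurable_fst
  · exact (StronglyMeasurable.integral_kernel_prod_right'
      (κ := (alg.enhancer t).comap (fun p : (Fin t → Round X A) × X => (p.1, p.2, p.2))
        (by fun_prop))
      (f := fun q : ((Fin t → Round X A) × X) × A => M.φ q.1.2 q.2)
      (hM.measurable_φ.comp (f := fun q : ((Fin t → Round X A) × X) × A => (q.1.2, q.2))
        (by fun_prop)).stronglyMeasurable).measurable
  · exact (StronglyMeasurable.integral_kernel_prod_right' (κ := alg.main t)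
      (f := fun q : ((Fin t → Round X A) × X) × A => M.φ q.1.2 q.2)
      (hM.measurable_φ.comp (f := fun q : ((Fin t → Round X A) × X) × A => (q.1.2, q.2))
        (by fun_prop)).stronglyMeasurable).measurable

lemma integrable_width (hlam : 0 < lam) (t : ℕ) (D : Fin t → Round X A) :
    Integrable (alg.width t D) M.d₀ := by
  have := hM.prob_d₀
  refine Integrable.of_bound (C := 4 / lam)
    ((alg.measurable_width hM t).of_uncurry_left (x := D)).aestronglyMeasurable
    (ae_of_all _ fun x => ?_)
  rw [Real.norm_of_nonneg (alg.width_nonneg t D x)]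
  exact alg.width_le hM hlam t D x

/-- With m = 4/λ bounding the gain Y, E e^{-Y/m} ≤ 1 − E Y/(2m). The width is at most E Y by Jensen,
done here with a supporting hyperplane so that only means of φ are integrated. -/
lemma stepLIntegral_exp_width_sub_gain (hlam : 0 < lam) (t : ℕ) (D : Fin t → Round X A) :
    alg.stepLIntegral t D (fun z => ENNReal.ofReal
      (Real.exp ((alg.width t D z.1 / 2 - M.gain lam D z) / (4 / lam)))) ≤ 1 := by
  have := hM.prob_d₀
  set m := 4 / lam with hm
  have hm0 : 0 < m := by positivity
  -- The gain ignores the label, so fixing it to `true` changes nothing.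
  have hstep := alg.stepLIntegral_of_forall_label t D (fun x a₁ a₂ => ENNReal.ofReal
      (Real.exp ((alg.width t D x / 2 - M.gain lam D (x, a₁, a₂, true)) / m)))
  refine (le_of_eq hstep).trans ?_
  refine (lintegral_mono (g := fun _ => 1) fun x => ?_).trans (by simp)
  have h1 := alg.isProbabilityMeasure_main hM t (D, x)
  have h2 := alg.isProbabilityMeasure_enhancer hM t (D, x, x)
  dsimp only
  set S := (M.cov lam D)⁻¹ with hS
  set v : Feat d := WithLp.toLp 2 (S.mulVec (alg.gap t D x).ofLp) with hv
  set w := alg.width t D x with hw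
  have hSpos : S.PosSemidef := (M.cov_posDef hlam D).inv.posSemidef
  have hwv : w = inner ℝ v (alg.gap t D x) := by
    rw [hw, width, matNorm_sq hSpos, inner_eq_dotProduct, dotProduct_comm]
  -- the supporting hyperplane of the quadratic form at the feature gap
  have hgain : ∀ a₁ a₂, 2 * inner ℝ v (M.φ x a₂ - M.φ x a₁) - w ≤
      M.gain lam D (x, a₁, a₂, true) := by
    intro a₁ a₂
    have h := hSpos.dotProduct_mulVec_nonneg ((M.φ x a₂ - M.φ x a₁) - alg.gap t D x).ofLp
    have hg : M.gain lam D (x, a₁, a₂, true) =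
        (M.φ x a₂ - M.φ x a₁).ofLp ⬝ᵥ S.mulVec (M.φ x a₂ - M.φ x a₁).ofLp := by
      rw [gain, featDiff, ← neg_sub, matNorm_neg, matNorm_sq hSpos]
    have hw' : w = (alg.gap t D x).ofLp ⬝ᵥ S.mulVec (alg.gap t D x).ofLp := by
      rw [hw, width, matNorm_sq hSpos]
    rw [hg, hw', inner_eq_dotProduct]
    rw [star_trivial, WithLp.ofLp_sub _ (M.φ x a₂ - M.φ x a₁), Matrix.mulVec_sub,
      sub_dotProduct, dotProduct_sub, dotProduct_sub,
      dotProduct_mulVec_comm hSpos.isHermitian (alg.gap t D x).ofLp,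
      dotProduct_comm _ (S.mulVec (alg.gap t D x).ofLp)] at h
    linarith
  have hint1 : Integrable (M.φ x) (alg.main t (D, x)) := hM.integrable_φ x _
  have hint2 : Integrable (M.φ x) (alg.enhancer t (D, x, x)) := hM.integrable_φ x _
  -- Affine in each of the two feature vectors; its iterated integral over the two independent
  -- actions therefore depends only on the mean gap and equals 1 − w/(2m).
  let L : A → A → ℝ := fun a₁ a₂ => 1 - (2 * inner ℝ v (M.φ x a₂ - M.φ x a₁) - w) / (2 * m)
  have hL : ∀ a₁ a₂, Real.exp (-(M.gain lam D (x, a₁, a₂, true) / m)) ≤ L a₁ a₂ := by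
    intro a₁ a₂
    have hy1 : M.gain lam D (x, a₁, a₂, true) / m ≤ 1 := by
      rw [div_le_one hm0]
      exact gain_le hM.norm_φ_le hlam D _
    refine (exp_neg_le_one_sub_half (div_nonneg (M.gain_nonneg lam D _) hm0.le) hy1).trans ?_
    have := hgain a₁ a₂
    have h3 : (2 * inner ℝ v (M.φ x a₂ - M.φ x a₁) - w) / (2 * m) ≤
        M.gain lam D (x, a₁, a₂, true) / (2 * m) := by gcongr
    have h4 : M.gain lam D (x, a₁, a₂, true) / (2 * m) =
        M.gain lam D (x, a₁, a₂, true) / m / 2 := by field_simp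
    simp only [L]
    linarith
  have hL2 : ∀ a₁, Integrable (L a₁) (alg.enhancer t (D, x, x)) := fun a₁ =>
    (integrable_const _).sub (((((hint2.sub (integrable_const _)).const_inner v).const_mul _).sub
      (integrable_const _)).div_const _)
  have hL2i : ∀ a₁, ∫ a₂, L a₁ a₂ ∂(alg.enhancer t (D, x, x)) =
      1 - (2 * inner ℝ v (∫ a₂, M.φ x a₂ ∂(alg.enhancer t (D, x, x)) - M.φ x a₁) - w)
        / (2 * m) := by
    intro a₁
    simp only [L]
    rw [integral_sub (integrable_const _)
      (((((hint2.sub (integrable_const _)).const_inner v).const_mul _).sub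
      (integrable_const _)).div_const _), integral_div, integral_sub
      (((hint2.sub (integrable_const _)).const_inner v).const_mul _) (integrable_const _),
      integral_const_mul, integral_inner (f := fun a => M.φ x a - M.φ x a₁) (hint2.sub (integrable_const _)),
      integral_sub hint2 (integrable_const _)]
    simp
  have hL1 : Integrable (fun a₁ => ∫ a₂, L a₁ a₂ ∂(alg.enhancer t (D, x, x)))
      (alg.main t (D, x)) := by
    simp only [hL2i]
    exact (integrable_const _).sub ((((((integrable_const _).sub hint1).const_inner v).const_mul
      _).sub (integrable_const _)).div_const _)
  have hL1i : ∫ a₁, ∫ a₂, L a₁ a₂ ∂(alg.enhancer t (D, x, x)) ∂(alg.main t (D, x)) =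
      1 - w / (2 * m) := by
    simp only [hL2i]
    rw [integral_sub (integrable_const _)
      ((((((integrable_const _).sub hint1).const_inner v).const_mul
      _).sub (integrable_const _)).div_const _), integral_div, integral_sub
      ((((integrable_const _).sub hint1).const_inner v).const_mul _) (integrable_const _),
      integral_const_mul, integral_inner (f := fun a => ∫ a₂, M.φ x a₂ ∂(alg.enhancer t (D, x, x)) - M.φ x a)
        ((integrable_const _).sub hint1),
      integral_sub (integrable_const _) hint1]
    simp only [integral_const, probReal_univ, one_smul]
    change 1 - (2 * inner ℝ v (alg.gap t D x) - w) / (2 * m) = _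
    rw [← hwv]
    ring
  have hLpos : ∀ a₁ a₂, 0 ≤ L a₁ a₂ := fun a₁ a₂ => (Real.exp_pos _).le.trans (hL a₁ a₂)
  calc ∫⁻ a₁, ∫⁻ a₂, ENNReal.ofReal
        (Real.exp ((w / 2 - M.gain lam D (x, a₁, a₂, true)) / m))
        ∂(alg.enhancer t (D, x, x)) ∂(alg.main t (D, x))
      ≤ ∫⁻ a₁, ∫⁻ a₂, ENNReal.ofReal (Real.exp (w / (2 * m))) * ENNReal.ofReal (L a₁ a₂)
        ∂(alg.enhancer t (D, x, x)) ∂(alg.main t (D, x)) := by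
        refine lintegral_mono fun a₁ => lintegral_mono fun a₂ => ?_
        dsimp only
        rw [← ENNReal.ofReal_mul (Real.exp_pos _).le]
        refine ENNReal.ofReal_le_ofReal ?_
        have h3 : (w / 2 - M.gain lam D (x, a₁, a₂, true)) / m =
            w / (2 * m) + -(M.gain lam D (x, a₁, a₂, true) / m) := by field_simp; ring
        rw [h3, Real.exp_add]
        exact mul_le_mul_of_nonneg_left (hL a₁ a₂) (Real.exp_pos _).le
    _ = ENNReal.ofReal (Real.exp (w / (2 * m))) * ENNReal.ofReal (1 - w / (2 * m)) := by
        simp only [lintegral_const_mul' _ _ ENNReal.ofReal_ne_top]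
        congr 1
        have h3 : ∀ a₁, ∫⁻ a₂, ENNReal.ofReal (L a₁ a₂) ∂(alg.enhancer t (D, x, x)) =
            ENNReal.ofReal (∫ a₂, L a₁ a₂ ∂(alg.enhancer t (D, x, x))) := fun a₁ =>
          (ofReal_integral_eq_lintegral_ofReal (hL2 a₁) (ae_of_all _ (hLpos a₁))).symm
        simp only [h3]
        rw [← ofReal_integral_eq_lintegral_ofReal hL1
          (ae_of_all _ fun a₁ => integral_nonneg (hLpos a₁)), hL1i]
    _ ≤ 1 := by
        rw [← ENNReal.ofReal_mul (Real.exp_pos _).le, ← ENNReal.ofReal_one]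
        refine ENNReal.ofReal_le_ofReal ?_
        have h3 := Real.add_one_le_exp (-(w / (2 * m)))
        have h4 : Real.exp (w / (2 * m)) * Real.exp (-(w / (2 * m))) = 1 := by
          rw [← Real.exp_add]; simp
        nlinarith [Real.exp_pos (w / (2 * m))]

/-- The same multiplicative lower-tail argument, now with only the prompt random: the enhancer's
bonus is seen at x_t, while the regret involves its average over d₀. -/
lemma stepLIntegral_exp_integral_width_sub (hlam : 0 < lam) (t : ℕ) (D : Fin t → Round X A) :
    alg.stepLIntegral t D (fun z => ENNReal.ofReal
      (Real.exp (((∫ x, alg.width t D x ∂M.d₀) / 2 - alg.width t D z.1) / (4 / lam)))) ≤ 1 := by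
  have := hM.prob_d₀
  set m := 4 / lam with hm
  have hm0 : 0 < m := by positivity
  set V := ∫ x, alg.width t D x ∂M.d₀ with hV
  have hstep := alg.stepLIntegral_of_forall_label t D (fun x _ _ => ENNReal.ofReal
      (Real.exp ((V / 2 - alg.width t D x) / m)))
  refine (le_of_eq hstep).trans ?_
  have h1 := fun x => (alg.isProbabilityMeasure_enhancer hM t (D, x, x)).measure_univ
  have h2 := fun x => (alg.isProbabilityMeasure_main hM t (D, x)).measure_univ
  simp only [lintegral_const, h1, h2, mul_one]
  have hint := alg.integrable_width hM hlam t D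
  have hL : ∀ x, Real.exp (-(alg.width t D x / m)) ≤ 1 - alg.width t D x / m / 2 := fun x =>
    exp_neg_le_one_sub_half (div_nonneg (alg.width_nonneg t D x) hm0.le)
      ((div_le_one hm0).2 (alg.width_le hM hlam t D x))
  calc ∫⁻ x, ENNReal.ofReal (Real.exp ((V / 2 - alg.width t D x) / m)) ∂M.d₀
      ≤ ∫⁻ x, ENNReal.ofReal (Real.exp (V / m / 2)) *
          ENNReal.ofReal (1 - alg.width t D x / m / 2) ∂M.d₀ := by
        refine lintegral_mono fun x => ?_
        dsimp only
        rw [← ENNReal.ofReal_mul (Real.exp_pos _).le]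
        refine ENNReal.ofReal_le_ofReal ?_
        have h3 : (V / 2 - alg.width t D x) / m = V / m / 2 + -(alg.width t D x / m) := by ring
        rw [h3, Real.exp_add]
        exact mul_le_mul_of_nonneg_left (hL x) (Real.exp_pos _).le
    _ = ENNReal.ofReal (Real.exp (V / m / 2)) * ENNReal.ofReal (1 - V / m / 2) := by
        rw [lintegral_const_mul' _ _ ENNReal.ofReal_ne_top,
          ← ofReal_integral_eq_lintegral_ofReal
            (f := fun x => 1 - alg.width t D x / m / 2) ((integrable_const _).sub ((hint.div_const _).div_const _))
            (ae_of_all _ fun x => (Real.exp_pos _).le.trans (hL x)),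
          integral_sub (integrable_const _) ((hint.div_const _).div_const _), integral_div,
          integral_div]
        simp [hV]
    _ ≤ 1 := by
        rw [← ENNReal.ofReal_mul (Real.exp_pos _).le, ← ENNReal.ofReal_one]
        refine ENNReal.ofReal_le_ofReal ?_
        have h3 := Real.add_one_le_exp (-(V / m / 2))
        have h4 : Real.exp (V / m / 2) * Real.exp (-(V / m / 2)) = 1 := by
          rw [← Real.exp_add]; simp
        nlinarith [Real.exp_pos (V / m / 2)]

end Model.OptionII

end

/-! ### Likelihood ratios and confidence ellipsoids -/

section

variable {X A : Type*} [MeasurableSpace X] [MeasurableSpace A] {d : ℕ}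
  {M : Model X A d} {lam β : ℝ}

namespace Model

/-- The Bradley-Terry likelihood of the label of a round. -/
noncomputable def likelihood (M : Model X A d) (θ : Feat d) (z : Round X A) : ℝ :=
  Real.sigmoid (if z.2.2.2 = true then inner ℝ θ (M.featDiff z) else -inner ℝ θ (M.featDiff z))

/-- Half the log-likelihood ratio of a round, compensated by a lower bound for the squared
Hellinger distance. -/
noncomputable def compensatedRatio (M : Model X A d) (θStar θ : Feat d) (z : Round X A) : ℝ :=
  (Real.log (M.likelihood θ z) - Real.log (M.likelihood θStar z)) / 2 +
    (Real.sigmoid (inner ℝ θ (M.featDiff z)) - Real.sigmoid (inner ℝ θStar (M.featDiff z))) ^ 2 / 4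

lemma inner_featDiff (M : Model X A d) (θ : Feat d) (z : Round X A) :
    inner ℝ θ (M.featDiff z) = M.reward θ z.1 z.2.1 - M.reward θ z.1 z.2.2.1 :=
  inner_sub_right _ _ _

lemma logLik_eq_sum (M : Model X A d) {t : ℕ} (D : Fin t → Round X A) (θ : Feat d) :
    M.logLik D θ = ∑ i, Real.log (M.likelihood θ (D i)) := by
  refine Finset.sum_congr rfl fun i _ => ?_
  rcases D i with ⟨x, a₁, a₂, y⟩
  cases y <;> simp [likelihood, inner_featDiff]

lemma log_likelihood_sub_le (M : Model X A d) (θ θ' : Feat d) (z : Round X A) :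
    Real.log (M.likelihood θ z) - Real.log (M.likelihood θ' z) ≤
      |inner ℝ (θ - θ') (M.featDiff z)| := by
  refine (log_sigmoid_sub_le _ _).trans (le_of_eq ?_)
  rw [inner_sub_left]
  split_ifs
  · rfl
  · rw [← abs_neg]
    congr 1
    ring

lemma abs_inner_featDiff_le (hM : M.LinearAssumption) (θ : Feat d) (z : Round X A) :
    |inner ℝ θ (M.featDiff z)| ≤ 2 * ‖θ‖ := by
  refine (abs_real_inner_le_norm _ _).trans ?_
  nlinarith [norm_featDiff_le hM.norm_φ_le z, norm_nonneg θ]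

lemma measurable_compensatedRatio (hM : M.LinearAssumption) (θStar : Feat d) :
    Measurable fun p : Feat d × Round X A => M.compensatedRatio θStar p.1 p.2 := by
  have h1 : Measurable fun p : Feat d × Round X A => inner ℝ p.1 (M.featDiff p.2) :=
    Measurable.inner measurable_fst (hM.measurable_featDiff.comp measurable_snd)
  have h2 : Measurable fun p : Feat d × Round X A => inner ℝ θStar (M.featDiff p.2) :=
    Measurable.inner measurable_const (hM.measurable_featDiff.comp measurable_snd)
  have hs : MeasurableSet {p : Feat d × Round X A | p.2.2.2.2 = true} :=
    (measurable_snd.snd.snd.snd : Measurable fun p : Feat d × Round X A => p.2.2.2.2)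
      (measurableSet_singleton true)
  have hσ : Measurable Real.sigmoid := continuous_sigmoid.measurable
  exact ((((hσ.comp (Measurable.ite hs h1 h1.neg)).log).sub
    ((hσ.comp (Measurable.ite hs h2 h2.neg)).log)).div_const _).add
    ((((hσ.comp h1).sub (hσ.comp h2)).pow_const _).div_const _)

lemma exp_half_log_sub {p q : ℝ} (hp : 0 < p) (hq : 0 < q) :
    q * Real.exp ((Real.log p - Real.log q) / 2) = √(p * q) := by
  rw [Real.sqrt_eq_rpow, Real.rpow_def_of_pos (by positivity), Real.log_mul hp.ne' hq.ne']
  nth_rw 1 [← Real.exp_log hq]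
  rw [← Real.exp_add]
  congr 1
  ring

/-- Halving the log-ratio turns the expectation over the label into the Hellinger affinity, and the
compensator cancels its exponential upper bound. This holds prompt by prompt and action by action.
-/
lemma stepLIntegral_exp_compensatedRatio (alg : M.OptionII lam β) (hM : M.LinearAssumption)
    {θStar : Feat d} (hθStar : ∀ x a, M.rStar x a = inner ℝ θStar (M.φ x a)) (θ : Feat d) (t : ℕ)
    (D : Fin t → Round X A) :
    alg.stepLIntegral t D (fun z => ENNReal.ofReal (Real.exp (M.compensatedRatio θStar θ z))) ≤
      1 := by
  refine alg.stepLIntegral_le_of_label hM t D fun x a₁ a₂ => ?_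
  have hu : M.rStar x a₁ - M.rStar x a₂ = inner ℝ θStar (M.φ x a₁ - M.φ x a₂) := by
    rw [hθStar, hθStar, inner_sub_right]
  have hu' : M.rStar x a₂ - M.rStar x a₁ = -inner ℝ θStar (M.φ x a₁ - M.φ x a₂) := by
    rw [← hu]; ring
  rw [hu, hu', ← ENNReal.ofReal_mul (Real.sigmoid_nonneg _),
    ← ENNReal.ofReal_mul (Real.sigmoid_nonneg _), ← ENNReal.ofReal_add
    (mul_nonneg (Real.sigmoid_nonneg _) (Real.exp_pos _).le)
    (mul_nonneg (Real.sigmoid_nonneg _) (Real.exp_pos _).le), ← ENNReal.ofReal_one]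
  refine ENNReal.ofReal_le_ofReal ?_
  simp only [compensatedRatio, likelihood, featDiff, if_true, Bool.false_eq_true, if_false,
    Real.exp_add, ← mul_assoc]
  set u := inner ℝ θ (M.φ x a₁ - M.φ x a₂)
  set v := inner ℝ θStar (M.φ x a₁ - M.φ x a₂)
  rw [exp_half_log_sub (Real.sigmoid_pos _) (Real.sigmoid_pos _),
    exp_half_log_sub (Real.sigmoid_pos _) (Real.sigmoid_pos _), ← add_mul, Real.sigmoid_neg,
    Real.sigmoid_neg]
  have h := sqrt_mul_add_sqrt_mul_le_exp (p := Real.sigmoid u) (q := Real.sigmoid v)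
    ⟨Real.sigmoid_nonneg _, Real.sigmoid_le_one _⟩ ⟨Real.sigmoid_nonneg _, Real.sigmoid_le_one _⟩
  calc _ ≤ Real.exp (-((Real.sigmoid u - Real.sigmoid v) ^ 2 / 4)) *
        Real.exp ((Real.sigmoid u - Real.sigmoid v) ^ 2 / 4) := by gcongr
    _ = 1 := by rw [← Real.exp_add]; simp

end Model

/-- If the average of `G` over a ball is small, then each small ball around a point of the
concentric smaller ball contains a point at which `G` is small. -/
lemma exists_mem_ball_le {G : Feat d → ℝ≥0∞} {B ε K : ℝ} (hε : 0 < ε) (hK : 0 ≤ K)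
    (hG : ∫⁻ θ in Metric.ball 0 (B + ε), G θ <
      ENNReal.ofReal K * volume (Metric.ball (0 : Feat d) (B + ε)))
    {θ₀ : Feat d} (hθ₀ : ‖θ₀‖ ≤ B) :
    ∃ θ ∈ Metric.ball θ₀ ε, G θ ≤ ENNReal.ofReal (K * ((B + ε) / ε) ^ d) := by
  by_contra! h
  have hB : 0 ≤ B := (norm_nonneg _).trans hθ₀
  refine absurd hG (not_lt.2 ?_)
  have hsub : Metric.ball θ₀ ε ⊆ Metric.ball 0 (B + ε) :=
    Metric.ball_subset_ball' (by rw [dist_zero_right]; linarith)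
  calc ENNReal.ofReal K * volume (Metric.ball (0 : Feat d) (B + ε))
      = ENNReal.ofReal (K * ((B + ε) / ε) ^ d) * volume (Metric.ball θ₀ ε) := by
        rw [Measure.addHaar_ball_of_pos _ _ (by linarith : 0 < B + ε),
          Measure.addHaar_ball_of_pos _ θ₀ hε, ← mul_assoc, ← mul_assoc,
          ← ENNReal.ofReal_mul hK, ← ENNReal.ofReal_mul (by positivity),
          finrank_euclideanSpace_fin]
        congr 2
        rw [div_pow]
        field_simp
    _ = ∫⁻ _ in Metric.ball θ₀ ε, ENNReal.ofReal (K * ((B + ε) / ε) ^ d) := by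
        rw [lintegral_const, Measure.restrict_apply_univ]
    _ ≤ ∫⁻ θ in Metric.ball θ₀ ε, G θ :=
        setLIntegral_mono' Metric.isOpen_ball.measurableSet fun θ hθ => (h θ hθ).le
    _ ≤ _ := lintegral_mono_set hsub

section Run

variable {Ω : Type*} [MeasurableSpace Ω] {P : Measure Ω} {alg : M.OptionII lam β} {T : ℕ}
  {Z : ℕ → Ω → Round X A}

/-- The exponential of the compensated log-likelihood ratio, averaged over a ball of parameters,
exceeds its prior volume by the factor `c` with probability at most `1 / c`. -/
lemma IsRun.measure_mixture_ge [IsProbabilityMeasure P] (hrun : IsRun alg P T Z)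
    (hM : M.LinearAssumption) {θStar : Feat d}
    (hθStar : ∀ x a, M.rStar x a = inner ℝ θStar (M.φ x a)) {t : ℕ} (ht : t ≤ T) {R c : ℝ}
    (hR : 0 < R) (hc : 0 < c) :
    P {ω | ENNReal.ofReal c * volume (Metric.ball (0 : Feat d) R) ≤
        ∫⁻ θ in Metric.ball (0 : Feat d) R, ∏ s ∈ Finset.range t,
          ENNReal.ofReal (Real.exp (M.compensatedRatio θStar θ (Z s ω)))} ≤
      ENNReal.ofReal (1 / c) := by
  set V := volume (Metric.ball (0 : Feat d) R) with hV
  have hVpos : V ≠ 0 := (Metric.measure_ball_pos volume _ hR).ne'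
  have hVtop : V ≠ ∞ := measure_ball_lt_top.ne
  have hmeas : Measurable fun p : Ω × Feat d => ∏ s ∈ Finset.range t,
      ENNReal.ofReal (Real.exp (M.compensatedRatio θStar p.2 (Z s p.1))) := by
    refine Finset.measurable_prod _ fun s _ => ?_
    have := (Model.measurable_compensatedRatio hM θStar).comp
      (measurable_snd.prodMk ((hrun.measurable s).comp measurable_fst) :
        Measurable fun p : Ω × Feat d => (p.2, Z s p.1))
    exact this.exp.ennreal_ofReal
  have hle : ∫⁻ ω, (∫⁻ θ in Metric.ball (0 : Feat d) R, ∏ s ∈ Finset.range t,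
      ENNReal.ofReal (Real.exp (M.compensatedRatio θStar θ (Z s ω)))) ∂P ≤ V := by
    -- Tonelli: for each fixed θ the product has expectation at most 1.
    rw [lintegral_lintegral_swap hmeas.aemeasurable]
    calc _ ≤ ∫⁻ _ in Metric.ball (0 : Feat d) R, 1 := lintegral_mono fun θ => ?_
      _ = V := by simp [hV]
    exact hrun.lintegral_prod_le_one
      (f := fun s _ z => ENNReal.ofReal (Real.exp (M.compensatedRatio θStar θ z)))
      (fun s => ((Model.measurable_compensatedRatio hM θStar).comp
        (measurable_const.prodMk measurable_snd)).exp.ennreal_ofReal)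
      (fun _ _ _ => ENNReal.ofReal_ne_top)
      (fun s D => Model.stepLIntegral_exp_compensatedRatio alg hM hθStar θ s D) ht
  refine (meas_ge_le_lintegral_div hmeas.lintegral_prod_right'.aemeasurable
    (mul_ne_zero (by simpa using hc) hVpos) (ENNReal.mul_ne_top ENNReal.ofReal_ne_top hVtop)).trans
    ?_
  calc _ ≤ V / (ENNReal.ofReal c * V) := by gcongr
    _ = ENNReal.ofReal (1 / c) := by
      rw [one_div, ENNReal.ofReal_inv_of_pos hc, ENNReal.div_eq_inv_mul,
        ENNReal.mul_inv (Or.inr hVtop) (Or.inr hVpos), mul_assoc,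
        ENNReal.inv_mul_cancel hVpos hVtop, mul_one]

end Run

/-- The deterministic part of the maximum likelihood analysis: a parameter close to the maximum
likelihood estimator with a small compensated likelihood ratio controls the prediction error. -/
lemma sum_inner_sq_le_of_isMLE (hM : M.LinearAssumption) {θStar : Feat d} (hB : ‖θStar‖ ≤ M.B)
    (hθStar : ∀ x a, M.rStar x a = inner ℝ θStar (M.φ x a)) {t T : ℕ} (ht : t ≤ T) (hT : 0 < T)
    {D : Fin t → Round X A} {θHat θ : Feat d} (hMLE : M.IsMLE D θHat)
    (hθ : θ ∈ Metric.ball θHat (1 / T)) {C : ℝ}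
    (hC : ∑ i, M.compensatedRatio θStar θ (D i) ≤ C) :
    ∑ i, inner ℝ (θHat - θStar) (M.featDiff (D i)) ^ 2 ≤
      8192 * (2 + M.B) ^ 2 * (1 + C) + 8 := by
  have hT1 : (1 : ℝ) ≤ T := by exact_mod_cast hT
  have htT : (t : ℝ) ≤ T := by exact_mod_cast ht
  have hBpos := hM.B_pos
  have hnorm : ‖θHat - θ‖ ≤ 1 / T := by
    rw [Metric.mem_ball, dist_comm, dist_eq_norm] at hθ; exact hθ.le
  have hinv : (1 : ℝ) / T ≤ 1 := by rw [div_le_one (by linarith)]; exact hT1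
  have hHat : ‖θHat‖ ≤ M.B := by simpa using hMLE.1
  have hθn : ‖θ‖ ≤ M.B + 1 := by
    have := norm_sub_norm_le θ θHat
    rw [norm_sub_rev] at this
    linarith
  have hdiff : ∀ i, |inner ℝ (θHat - θ) (M.featDiff (D i))| ≤ 2 / T := fun i => by
    refine (Model.abs_inner_featDiff_le hM _ _).trans ?_
    calc 2 * ‖θHat - θ‖ ≤ 2 * (1 / T) := by gcongr
      _ = 2 / T := by ring
  have hstar : ∀ i, |inner ℝ θStar (M.featDiff (D i))| ≤ 1 := fun i => by
    rw [Model.inner_featDiff, Model.reward, Model.reward, ← hθStar, ← hθStar, abs_le]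
    have h1 := hM.reward_mem (D i).1 (D i).2.1
    have h2 := hM.reward_mem (D i).1 (D i).2.2.1
    constructor <;> linarith [h1.1, h1.2, h2.1, h2.2]
  -- Each log-likelihood term moves by at most 2/T between the estimator and θ, and there are at
  -- most T rounds.
  have hlik : M.logLik D θStar ≤ M.logLik D θ + 2 := by
    have h1 : M.logLik D θStar ≤ M.logLik D θHat := hMLE.2 (by simpa using hB)
    have h2 : M.logLik D θHat - M.logLik D θ ≤ ∑ _i : Fin t, (2 / T : ℝ) := by
      rw [M.logLik_eq_sum, M.logLik_eq_sum, ← Finset.sum_sub_distrib]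
      exact Finset.sum_le_sum fun i _ => (M.log_likelihood_sub_le _ _ _).trans (hdiff i)
    have h3 : ∑ _i : Fin t, (2 / T : ℝ) ≤ 2 := by
      rw [Finset.sum_const, Finset.card_univ, Fintype.card_fin, nsmul_eq_mul, mul_div_assoc',
        div_le_iff₀ (by linarith)]
      linarith
    linarith
  set S := ∑ i, (Real.sigmoid (inner ℝ θ (M.featDiff (D i))) -
    Real.sigmoid (inner ℝ θStar (M.featDiff (D i)))) ^ 2 with hS
  have hSC : S ≤ 4 * (1 + C) := by
    have h1 : ∑ i, M.compensatedRatio θStar θ (D i) =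
        (M.logLik D θ - M.logLik D θStar) / 2 + S / 4 := by
      simp only [Model.compensatedRatio]
      rw [Finset.sum_add_distrib, ← Finset.sum_div, ← Finset.sum_div, Finset.sum_sub_distrib,
        ← M.logLik_eq_sum, ← M.logLik_eq_sum]
    linarith
  have hterm : ∀ i, inner ℝ (θHat - θStar) (M.featDiff (D i)) ^ 2 ≤
      2048 * (2 + M.B) ^ 2 * (Real.sigmoid (inner ℝ θ (M.featDiff (D i))) -
        Real.sigmoid (inner ℝ θStar (M.featDiff (D i)))) ^ 2 + 8 / T := by
    intro i
    set u := inner ℝ θ (M.featDiff (D i)) with hu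
    set v := inner ℝ θStar (M.featDiff (D i)) with hv
    -- The radius is B + 1 since θ may lie outside the parameter ball by up to 1/T.
    have h1 := abs_sub_le_abs_sigmoid_sub (u := u) (v := v) (B := M.B + 1) (hstar i)
      ((Model.abs_inner_featDiff_le hM _ _).trans (by linarith))
    have h2 : (u - v) ^ 2 ≤
        1024 * (2 + M.B) ^ 2 * (Real.sigmoid u - Real.sigmoid v) ^ 2 := by
      have := pow_le_pow_left₀ (abs_nonneg _) h1 2
      rw [mul_pow, sq_abs, sq_abs] at this
      linarith
    have h3 : inner ℝ (θHat - θ) (M.featDiff (D i)) ^ 2 ≤ 4 / T := by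
      have h4 := pow_le_pow_left₀ (abs_nonneg _) (hdiff i) 2
      rw [sq_abs] at h4
      refine h4.trans ?_
      have : (2 / T : ℝ) ^ 2 = 4 / T * (1 / T) := by ring
      rw [this]
      exact mul_le_of_le_one_right (by positivity) hinv
    have h5 : inner ℝ (θHat - θStar) (M.featDiff (D i)) =
        inner ℝ (θHat - θ) (M.featDiff (D i)) + (u - v) := by
      rw [hu, hv, ← inner_sub_left, ← inner_add_left]; simp
    have h6 : (8 / T : ℝ) = 2 * (4 / T) := by ring
    rw [h5, h6]
    nlinarith [sq_nonneg (inner ℝ (θHat - θ) (M.featDiff (D i)) - (u - v))]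
  refine (Finset.sum_le_sum fun i _ => hterm i).trans ?_
  rw [Finset.sum_add_distrib, ← Finset.mul_sum, ← hS]
  have h8 : ∑ _i : Fin t, (8 / T : ℝ) ≤ 8 := by
    rw [Finset.sum_const, Finset.card_univ, Fintype.card_fin, nsmul_eq_mul, mul_div_assoc',
      div_le_iff₀ (by linarith)]
    linarith
  nlinarith [sq_nonneg (2 + M.B)]

/-- The numerical bound that absorbs the covering and curvature constants into `1 / γ²`. -/
lemma mle_constant_le (hM : M.LinearAssumption) (hd : 0 < d) {T : ℕ} (hT : 0 < T) {δ : ℝ}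
    (hδ : 0 < δ) (hδ2 : δ ≤ 1 / 2) :
    8192 * (2 + M.B) ^ 2 * (1 + (Real.log (T / δ) + d * Real.log (1 + M.B * T))) + 8 ≤
      131088 * (d * Real.log (T / δ) / M.γ ^ 2) := by
  have hT1 : (1 : ℝ) ≤ T := by exact_mod_cast hT
  have hd1 : (1 : ℝ) ≤ d := by exact_mod_cast hd
  have hB := hM.B_pos
  set ℓ := Real.log (T / δ) with hℓ
  have hTδ : (T : ℝ) ≤ T / δ := by rw [le_div_iff₀ hδ]; nlinarith
  have hℓT : Real.log T ≤ ℓ := Real.log_le_log (by linarith) hTδ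
  have hℓ2 : 1 / 2 ≤ ℓ := by
    have h1 : (2 : ℝ) ≤ T / δ := by rw [le_div_iff₀ hδ]; nlinarith
    have := Real.log_le_log (by norm_num) h1
    linarith [Real.log_two_gt_d9]
  have hlog : Real.log (1 + M.B * T) ≤ ℓ + M.B := by
    have h1 : 1 + M.B * T ≤ T * (1 + M.B) := by nlinarith
    have h2 := Real.log_le_log (by positivity) h1
    rw [Real.log_mul (by positivity) (by positivity)] at h2
    have := Real.log_le_sub_one_of_pos (by positivity : 0 < 1 + M.B)
    linarith
  have hdℓ : ℓ ≤ d * ℓ := le_mul_of_one_le_left (by linarith) hd1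
  -- The volume ratio leaves d·B, hence a third power of 2 + B in total; `hcube` fits it under
  -- e^{2B} ≤ 1/γ².
  have hbr : 1 + (ℓ + d * Real.log (1 + M.B * T)) ≤ 2 * (2 + M.B) * (d * ℓ) := by
    have h1 : (d : ℝ) * Real.log (1 + M.B * T) ≤ d * (ℓ + M.B) := by gcongr
    have h2 : (d : ℝ) * M.B ≤ 2 * M.B * (d * ℓ) := by nlinarith [mul_pos (by linarith : (0:ℝ) < d) hB]
    nlinarith
  have hcube : (2 + M.B) ^ 3 ≤ 8 * Real.exp M.B ^ 2 := by
    have h1 : 2 + M.B ≤ 2 * Real.exp (M.B / 2) := by linarith [Real.add_one_le_exp (M.B / 2)]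
    have h2 := pow_le_pow_left₀ (by positivity) h1 3
    refine h2.trans ?_
    rw [mul_pow, ← Real.exp_nat_mul, ← Real.exp_nat_mul]
    have : Real.exp ((3 : ℕ) * (M.B / 2)) ≤ Real.exp ((2 : ℕ) * M.B) :=
      Real.exp_le_exp.2 (by push_cast; linarith)
    linarith
  have hγ : Real.exp M.B ^ 2 ≤ 1 / M.γ ^ 2 := by
    rw [Model.γ, div_pow, one_pow, one_div_one_div]
    gcongr
    linarith [Real.exp_pos (-M.B)]
  have hγ1 : 1 ≤ Real.exp M.B ^ 2 := one_le_pow₀ (Real.one_le_exp hB.le)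
  calc 8192 * (2 + M.B) ^ 2 * (1 + (ℓ + d * Real.log (1 + M.B * T))) + 8
      ≤ 8192 * (2 + M.B) ^ 2 * (2 * (2 + M.B) * (d * ℓ)) + 16 * (d * ℓ) := by
        have : 8 ≤ 16 * (d * ℓ) := by linarith
        gcongr
    _ = (16384 * (2 + M.B) ^ 3 + 16) * (d * ℓ) := by ring
    _ ≤ (131088 * Real.exp M.B ^ 2) * (d * ℓ) := by
        have : 0 ≤ d * ℓ := by linarith
        gcongr
        linarith
    _ ≤ (131088 * (1 / M.γ ^ 2)) * (d * ℓ) := by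
        have : 0 ≤ d * ℓ := by linarith
        gcongr
    _ = _ := by ring

section Run

variable {Ω : Type*} [MeasurableSpace Ω] {P : Measure Ω} {alg : M.OptionII lam β} {T : ℕ}
  {Z : ℕ → Ω → Round X A}

/-- The confidence ellipsoids of the maximum likelihood estimators hold uniformly over the rounds. -/
lemma IsRun.measure_exists_lt_matNorm [IsProbabilityMeasure P] (hrun : IsRun alg P T Z)
    (hM : M.LinearAssumption) (hd : 0 < d) (hT : 0 < T) (hlam : 0 < lam) {δ : ℝ} (hδ : 0 < δ)
    (hδ2 : δ ≤ 1 / 2)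
    (hβ : 1000 * √(d * Real.log (T / δ) / M.γ ^ 2 + lam * M.B ^ 2) ≤ β) {θStar : Feat d}
    (hB : ‖θStar‖ ≤ M.B) (hθStar : ∀ x a, M.rStar x a = inner ℝ θStar (M.φ x a)) :
    P {ω | ∃ t < T, β < 2 * matNorm (M.cov lam (hist Z t ω))
      (θStar - alg.θMLE t (hist Z t ω))} ≤ ENNReal.ofReal δ := by
  have hT0 : (0 : ℝ) < T := by exact_mod_cast hT
  have hBpos := hM.B_pos
  let bad : ℕ → Set Ω := fun t => {ω | ENNReal.ofReal (T / δ) *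
      volume (Metric.ball (0 : Feat d) (M.B + 1 / T)) ≤
        ∫⁻ θ in Metric.ball (0 : Feat d) (M.B + 1 / T), ∏ s ∈ Finset.range t,
          ENNReal.ofReal (Real.exp (M.compensatedRatio θStar θ (Z s ω)))}
  have hbad : ∀ t < T, P (bad t) ≤ ENNReal.ofReal (δ / T) := fun t ht => by
    have := hrun.measure_mixture_ge hM hθStar ht.le (R := M.B + 1 / T) (c := T / δ)
      (by positivity) (by positivity)
    rwa [one_div_div] at this
  have hsub : {ω | ∃ t < T, β < 2 * matNorm (M.cov lam (hist Z t ω))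
      (θStar - alg.θMLE t (hist Z t ω))} ⊆ ⋃ t ∈ Finset.range T, bad t := by
    rintro ω ⟨t, ht, hlt⟩
    simp only [Set.mem_iUnion, Finset.mem_range]
    refine ⟨t, ht, ?_⟩
    by_contra hnot
    refine absurd hlt (not_lt.2 ?_)
    simp only [bad, Set.mem_ofPred_eq, not_le] at hnot
    set D := hist Z t ω with hD
    have hMLE := alg.isMLE t D
    -- θ depends on the data; the mixture bound is what permits evaluating the supermartingale at
    -- it, for the volume ratio (1 + BT)^d.
    obtain ⟨θ, hθ, hGθ⟩ := exists_mem_ball_le (θ₀ := alg.θMLE t D) (by positivity)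
      (by positivity) hnot (by simpa using hMLE.1)
    have hC : ∑ i, M.compensatedRatio θStar θ (D i) ≤
        Real.log (T / δ) + d * Real.log (1 + M.B * T) := by
      have hq : (M.B + 1 / T) / (1 / T) = 1 + M.B * T := by field_simp; ring
      rw [← ENNReal.ofReal_prod_of_nonneg fun _ _ => (Real.exp_pos _).le, ← Real.exp_sum,
        ENNReal.ofReal_le_ofReal_iff (by positivity), hq,
        ← Real.le_log_iff_exp_le (by positivity), Real.log_mul (by positivity) (by positivity),
        Real.log_pow, Finset.sum_range] at hGθ
      exact hGθ
    have h1 := sum_inner_sq_le_of_isMLE hM hB hθStar ht.le hT hMLE hθ hC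
    have h2 := h1.trans (mle_constant_le hM hd hT hδ hδ2)
    have hnorm : ‖θStar - alg.θMLE t D‖ ^ 2 ≤ 4 * M.B ^ 2 := by
      have h3 : ‖alg.θMLE t D‖ ≤ M.B := by simpa using hMLE.1
      have h4 := norm_sub_le θStar (alg.θMLE t D)
      nlinarith [norm_nonneg (θStar - alg.θMLE t D)]
    have hsq : matNorm (M.cov lam D) (θStar - alg.θMLE t D) ^ 2 ≤
        131088 * (d * Real.log (T / δ) / M.γ ^ 2 + lam * M.B ^ 2) := by
      rw [M.matNorm_cov_sq hlam]
      have h3 : ∑ i, inner ℝ (θStar - alg.θMLE t D) (M.featDiff (D i)) ^ 2 =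
          ∑ i, inner ℝ (alg.θMLE t D - θStar) (M.featDiff (D i)) ^ 2 :=
        Finset.sum_congr rfl fun i _ => by rw [← neg_sub, inner_neg_left, neg_sq]
      rw [h3]
      nlinarith [mul_le_mul_of_nonneg_left hnorm hlam.le, mul_nonneg hlam.le (sq_nonneg M.B)]
    -- 131088 ≤ 500², and the factor 2 in the confidence event gives c_β = 1000.
    have h5 : matNorm (M.cov lam D) (θStar - alg.θMLE t D) ≤
        500 * √(d * Real.log (T / δ) / M.γ ^ 2 + lam * M.B ^ 2) := by
      set Q := d * Real.log (T / δ) / M.γ ^ 2 + lam * M.B ^ 2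
      have hQ : 0 ≤ Q := by nlinarith [sq_nonneg (matNorm (M.cov lam D) (θStar - alg.θMLE t D))]
      refine abs_le_of_sq_le_sq' ?_ (by positivity) |>.2
      rw [mul_pow, Real.sq_sqrt hQ]
      linarith
    linarith
  calc _ ≤ P (⋃ t ∈ Finset.range T, bad t) := measure_mono hsub
    _ ≤ ∑ t ∈ Finset.range T, P (bad t) := measure_biUnion_finset_le _ _
    _ ≤ ∑ _t ∈ Finset.range T, ENNReal.ofReal (δ / T) :=
        Finset.sum_le_sum fun t ht => hbad t (Finset.mem_range.1 ht)
    _ = ENNReal.ofReal δ := by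
        rw [Finset.sum_const, Finset.card_range, nsmul_eq_mul, ← ENNReal.ofReal_natCast,
          ← ENNReal.ofReal_mul (by positivity)]
        congr 1
        field_simp

end Run

end

/-! ### Per-round regret and summation -/

section

variable {X A : Type*} [MeasurableSpace X] [MeasurableSpace A] {d : ℕ}
  {M : Model X A d} {lam β : ℝ}

lemma measurable_of_uncurry_fst {α γ : Type*} [MeasurableSpace α] [MeasurableSpace γ]
    {F : α → X → ℝ} (hF : Measurable (Function.uncurry F)) :
    Measurable fun p : α × X × γ => F p.1 p.2.1 :=
  hF.comp (measurable_fst.prodMk measurable_snd.fst)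

namespace Model

lemma J_eq_value {θStar : Feat d} (hθStar : ∀ x a, M.rStar x a = inner ℝ θStar (M.φ x a))
    (π : Policy X A) : M.J π = M.value (M.reward θStar) π := by
  have : M.rStar = M.reward θStar := by
    funext x a
    exact hθStar x a
  rw [J, this]

end Model

namespace Model.OptionII

variable (alg : M.OptionII lam β) (hM : M.LinearAssumption)

lemma bonus_enhancer (t : ℕ) (D : Fin t → Round X A) (x : X) :
    M.bonus lam β D x (fun x' => alg.main t (D, x')) (fun x' => alg.enhancer t (D, x, x')) =
      β * √(alg.width t D x) := by
  rw [width, Real.sqrt_sq (matNorm_nonneg _ _)]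
  rfl

include hM

lemma measurable_width_round (t : ℕ) :
    Measurable fun p : (Fin t → Round X A) × Round X A => alg.width t p.1 p.2.1 :=
  measurable_of_uncurry_fst (F := alg.width t) (alg.measurable_width hM t)

lemma measurable_integral_width (t : ℕ) :
    Measurable fun D : Fin t → Round X A => ∫ x, alg.width t D x ∂M.d₀ := by
  have := hM.prob_d₀
  exact (StronglyMeasurable.integral_prod_right' (ν := M.d₀)
    (alg.measurable_width hM t).stronglyMeasurable).measurable

lemma integrable_sqrt_width (hlam : 0 < lam) (t : ℕ) (D : Fin t → Round X A) :
    Integrable (fun x => √(alg.width t D x)) M.d₀ := by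
  have := hM.prob_d₀
  refine Integrable.of_bound (C := √(4 / lam))
    ((alg.measurable_width hM t).of_uncurry_left (x := D)).sqrt.aestronglyMeasurable
    (ae_of_all _ fun x => ?_)
  rw [Real.norm_of_nonneg (Real.sqrt_nonneg _)]
  exact Real.sqrt_le_sqrt (alg.width_le hM hlam t D x)

lemma integral_sqrt_width_le (hlam : 0 < lam) (t : ℕ) (D : Fin t → Round X A) :
    ∫ x, √(alg.width t D x) ∂M.d₀ ≤ √(∫ x, alg.width t D x ∂M.d₀) := by
  have := hM.prob_d₀
  set c := ∫ x, √(alg.width t D x) ∂M.d₀ with hc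
  refine Real.le_sqrt_of_sq_le ?_
  have h1 := integral_mono (μ := M.d₀)
    (((alg.integrable_sqrt_width hM hlam t D).const_mul (2 * c)).sub (integrable_const (c ^ 2)))
    -- Jensen for the square root, by integrating (√w − c)² ≥ 0 with c the mean of √w.
    (alg.integrable_width hM hlam t D) fun x => by
      have h := Real.sq_sqrt (alg.width_nonneg t D x)
      simp only [Pi.sub_apply]
      nlinarith [sq_nonneg (√(alg.width t D x) - c)]
  simp only [Pi.sub_apply] at h1
  rw [integral_sub ((alg.integrable_sqrt_width hM hlam t D).const_mul (2 * c))
    (integrable_const _), integral_const_mul, ← hc] at h1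
  simp only [integral_const, probReal_univ, one_smul] at h1
  linarith

/-- The estimation error along any policy of the class is controlled, at every prompt, by the
enhancer's bonus and the averaged KL divergence. -/
lemma abs_inner_meanφ_sub_le (hlam : 0 < lam) {t : ℕ} {D : Fin t → Round X A} {θStar : Feat d}
    (hconf : 2 * matNorm (M.cov lam D) (θStar - alg.θMLE t D) ≤ β) {π : Policy X A}
    (hπ : π ∈ M.policyClass) (x : X) :
    |inner ℝ (θStar - alg.θMLE t D)
        (M.meanφ x π - M.meanφ x (fun x' => alg.main t (D, x')))| ≤
      (β * √(alg.width t D x) + M.η * M.expKL π (fun x' => alg.main t (D, x'))) / 2 := by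
  have hβ : 0 ≤ β := (mul_nonneg zero_le_two (matNorm_nonneg _ _)).trans hconf
  set π₁ : Policy X A := fun x' => alg.main t (D, x') with hπ₁
  have h1 : |inner ℝ (θStar - alg.θMLE t D) (M.meanφ x π - M.meanφ x π₁)| ≤
      M.bonus lam β D x π₁ π / 2 := by
    refine (abs_inner_le_matNorm_mul (M.cov_posDef hlam D) _ _).trans ?_
    rw [bonus, mul_div_right_comm]
    exact mul_le_mul_of_nonneg_right (by linarith) (matNorm_nonneg _ _)
  have hKL : 0 ≤ M.η * M.expKL π π₁ := mul_nonneg hM.η_pos.le (M.expKL_nonneg _ _)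
  have hw : 0 ≤ β * √(alg.width t D x) := mul_nonneg hβ (Real.sqrt_nonneg _)
  rcases le_or_gt (M.η * M.expKL π π₁) (M.bonus lam β D x π₁ π) with h | h
  · have h2 : M.bonus lam β D x π₁ π ≤ _ := alg.enhancer_max t D x ⟨hπ, h⟩
    rw [← hπ₁, alg.bonus_enhancer t D x] at h2
    linarith
  · linarith

lemma J_sub_J_main_eq {t : ℕ} {D : Fin t → Round X A} {θStar : Feat d}
    (hθStar : ∀ x a, M.rStar x a = inner ℝ θStar (M.φ x a)) {π : Policy X A}
    (hπ : π ∈ M.policyClass) :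
    M.J π - M.J (fun x' => alg.main t (D, x')) =
      ∫ x, inner ℝ (θStar - alg.θMLE t D)
        (M.meanφ x π - M.meanφ x (fun x' => alg.main t (D, x'))) ∂M.d₀ -
        M.η * M.expKL π (fun x' => alg.main t (D, x')) := by
  rw [J_eq_value hθStar, J_eq_value hθStar]
  exact hM.value_sub_value_eq (by simpa using (alg.isMLE t D).1) (alg.main_mem t D)
    (alg.main_max t D) hπ

lemma abs_integral_inner_le (hlam : 0 < lam) {t : ℕ} {D : Fin t → Round X A} {θStar : Feat d}
    (hconf : 2 * matNorm (M.cov lam D) (θStar - alg.θMLE t D) ≤ β) {π : Policy X A}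
    (hπ : π ∈ M.policyClass) :
    |∫ x, inner ℝ (θStar - alg.θMLE t D)
        (M.meanφ x π - M.meanφ x (fun x' => alg.main t (D, x'))) ∂M.d₀| ≤
      (β * ∫ x, √(alg.width t D x) ∂M.d₀ +
        M.η * M.expKL π (fun x' => alg.main t (D, x'))) / 2 := by
  have := hM.prob_d₀
  have hint := (alg.integrable_sqrt_width hM hlam t D).const_mul β
  set c := M.η * M.expKL π (fun x' => alg.main t (D, x')) with hc
  have hint' : Integrable (fun x => (β * √(alg.width t D x) + c) / 2) M.d₀ :=
    (hint.add (integrable_const c)).div_const 2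
  refine (norm_integral_le_of_norm_le hint'
    (f := fun x => inner ℝ (θStar - alg.θMLE t D)
      (M.meanφ x π - M.meanφ x (fun x' => alg.main t (D, x'))))
    (ae_of_all M.d₀ fun x => alg.abs_inner_meanφ_sub_le hM hlam hconf hπ x)).trans (le_of_eq ?_)
  rw [integral_div, integral_add hint (integrable_const _), integral_const_mul]
  simp

lemma J_sub_J_main_add_le (hlam : 0 < lam) {t : ℕ} {D : Fin t → Round X A} {θStar : Feat d}
    (hθStar : ∀ x a, M.rStar x a = inner ℝ θStar (M.φ x a))
    (hconf : 2 * matNorm (M.cov lam D) (θStar - alg.θMLE t D) ≤ β) {πStar : Policy X A}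
    (hopt : M.IsOptimal πStar) :
    M.J πStar - M.J (fun x' => alg.main t (D, x')) +
      M.η * M.expKL πStar (fun x' => alg.main t (D, x')) ≤
        β * ∫ x, √(alg.width t D x) ∂M.d₀ := by
  have h1 := alg.J_sub_J_main_eq hM (D := D) hθStar hopt.1
  have h2 := (abs_le.1 (alg.abs_integral_inner_le hM hlam hconf hopt.1)).2
  -- With I the integrated estimation error, nonnegative regret means η KL ≤ I. Then I ≤ (β E√width
  -- + η KL)/2 self-improves to I ≤ β E√width, and I is regret plus the full KL term.
  have h3 : M.J (fun x' => alg.main t (D, x')) ≤ M.J πStar := hopt.2 (alg.main_mem t D)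
  linarith

/-- The loss is η KL minus an estimation error that itself contains η KL/2; membership in the
enhancer's set bounds η KL by the bonus at the observed prompt, hence the 3/2. -/
lemma J_main_sub_J_enhancer_le (hlam : 0 < lam) {t : ℕ} {D : Fin t → Round X A} {θStar : Feat d}
    (hθStar : ∀ x a, M.rStar x a = inner ℝ θStar (M.φ x a))
    (hconf : 2 * matNorm (M.cov lam D) (θStar - alg.θMLE t D) ≤ β) (xObs : X) :
    M.J (fun x' => alg.main t (D, x')) - M.J (fun x' => alg.enhancer t (D, xObs, x')) ≤
      β * (3 / 2 * √(alg.width t D xObs) + 1 / 2 * ∫ x, √(alg.width t D x) ∂M.d₀) := by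
  obtain ⟨hmem, hKL⟩ := alg.enhancer_mem t D xObs
  have h1 := alg.J_sub_J_main_eq hM (D := D) hθStar hmem
  have h2 := (abs_le.1 (alg.abs_integral_inner_le hM hlam hconf hmem)).1
  rw [alg.bonus_enhancer] at hKL
  linarith

end Model.OptionII

lemma sum_sqrt_le_sqrt_mul {T : ℕ} {f : ℕ → ℝ} (hf : ∀ t, 0 ≤ f t) {Q : ℝ}
    (hQ : ∑ t ∈ Finset.range T, f t ≤ Q) : ∑ t ∈ Finset.range T, √(f t) ≤ √(T * Q) := by
  refine Real.le_sqrt_of_sq_le ((sq_sum_le_card_mul_sum_sq).trans ?_)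
  simp only [Finset.card_range, Real.sq_sqrt (hf _)]
  gcongr

section Run

variable {Ω : Type*} {T : ℕ} {alg : M.OptionII lam β} {Z : ℕ → Ω → Round X A}

/-- The regret bounds on the event that the confidence sets hold and the widths are summable. -/
lemma regret_le_of_confidence (hM : M.LinearAssumption) (hlam : 0 < lam) (hβ : 0 ≤ β)
    {θStar : Feat d} (hθStar : ∀ x a, M.rStar x a = inner ℝ θStar (M.φ x a)) {πStar : Policy X A}
    (hopt : M.IsOptimal πStar) {ω : Ω}
    (hconf : ∀ t < T, 2 * matNorm (M.cov lam (hist Z t ω))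
      (θStar - alg.θMLE t (hist Z t ω)) ≤ β) {Q : ℝ}
    (hw : ∑ t ∈ Finset.range T, alg.width t (hist Z t ω) (Z t ω).1 ≤ Q)
    (hv : ∑ t ∈ Finset.range T, ∫ x, alg.width t (hist Z t ω) x ∂M.d₀ ≤ Q) :
    regretAve alg Z πStar T ω ≤ 2 * (β * √(T * Q)) - M.η * sumKL alg Z πStar T ω ∧
      regret alg Z πStar T ω ≤ 2 * (β * √(T * Q)) - M.η * sumKL alg Z πStar T ω := by
  have hI : ∑ t ∈ Finset.range T, ∫ x, √(alg.width t (hist Z t ω) x) ∂M.d₀ ≤ √(T * Q) :=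
    (Finset.sum_le_sum fun t _ => alg.integral_sqrt_width_le hM hlam t _).trans
      (sum_sqrt_le_sqrt_mul (fun t => integral_nonneg fun x => alg.width_nonneg t _ x) hv)
  have hs : ∑ t ∈ Finset.range T, √(alg.width t (hist Z t ω) (Z t ω).1) ≤ √(T * Q) :=
    sum_sqrt_le_sqrt_mul (fun t => alg.width_nonneg t _ _) hw
  have hI' := mul_le_mul_of_nonneg_left hI hβ
  have hs' := mul_le_mul_of_nonneg_left hs hβ
  have hQ0 : 0 ≤ β * √(T * Q) := mul_nonneg hβ (Real.sqrt_nonneg _)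
  have hstep : ∀ t ∈ Finset.range T, M.J πStar - M.J (mainPolicy alg Z t ω) +
      M.η * M.expKL πStar (mainPolicy alg Z t ω) ≤
        β * ∫ x, √(alg.width t (hist Z t ω) x) ∂M.d₀ := fun t ht =>
    alg.J_sub_J_main_add_le hM hlam hθStar (hconf t (Finset.mem_range.1 ht)) hopt
  have hstep2 : ∀ t ∈ Finset.range T,
      M.J (mainPolicy alg Z t ω) - M.J (enhancerPolicy alg Z t ω) ≤
        3 / 2 * (β * √(alg.width t (hist Z t ω) (Z t ω).1)) +
          1 / 2 * (β * ∫ x, √(alg.width t (hist Z t ω) x) ∂M.d₀) := fun t ht => by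
    refine (alg.J_main_sub_J_enhancer_le hM hlam hθStar
      (hconf t (Finset.mem_range.1 ht)) (Z t ω).1).trans (le_of_eq ?_)
    ring
  have h1 := Finset.sum_le_sum hstep
  have h2 := Finset.sum_le_sum hstep2
  simp only [Finset.sum_add_distrib, ← Finset.mul_sum] at h1 h2
  have hreg : regret alg Z πStar T ω + M.η * sumKL alg Z πStar T ω ≤
      β * ∑ t ∈ Finset.range T, ∫ x, √(alg.width t (hist Z t ω) x) ∂M.d₀ := h1
  have hregAve : regretAve alg Z πStar T ω = regret alg Z πStar T ω +
      (∑ t ∈ Finset.range T,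
        (M.J (mainPolicy alg Z t ω) - M.J (enhancerPolicy alg Z t ω))) / 2 := by
    rw [regretAve, regret, Finset.sum_div, ← Finset.sum_add_distrib]
    exact Finset.sum_congr rfl fun t _ => by ring
  -- For the averaged regret the coefficients add to 1 + (3/2 + 1/2)/2 = 2.
  constructor <;> linarith

/-- In dimension zero all policies of the class coincide. -/
lemma regret_eq_zero_of_dim_zero {M : Model X A 0} {alg : M.OptionII lam β}
    (hM : M.LinearAssumption) {πStar : Policy X A} (hπ : πStar ∈ M.policyClass) (ω : Ω) :
    regretAve alg Z πStar T ω = 0 ∧ regret alg Z πStar T ω = 0 ∧ sumKL alg Z πStar T ω = 0 := by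
  have h : ∀ π ∈ M.policyClass, π = M.gibbs 0 := by
    rintro π ⟨θ, -, rfl⟩
    rw [Subsingleton.elim θ 0]
  have h1 : ∀ t, mainPolicy alg Z t ω = M.gibbs 0 := fun t => h _ (alg.main_mem t _)
  have h2 : ∀ t, enhancerPolicy alg Z t ω = M.gibbs 0 := fun t => h _ (alg.enhancer_mem t _ _).1
  have h3 : M.expKL (M.gibbs 0) (M.gibbs 0) = 0 := by
    have := hM.isProbabilityMeasure_gibbs 0
    simp [Model.expKL, InformationTheory.klDiv_self]
  simp only [regretAve, regret, sumKL, h1, h2, h πStar hπ, h3]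
  refine ⟨Finset.sum_eq_zero fun _ _ => by ring, by simp, by simp⟩

end Run

/-- Uses only monotonicity and subadditivity, so none of the events has to be measurable. -/
lemma ofReal_one_sub_two_mul_le {Ω : Type*} [MeasurableSpace Ω] {P : Measure Ω}
    [IsProbabilityMeasure P] {good U V : Set Ω} {δ : ℝ} (hδ : 0 ≤ δ)
    (hU : P U ≤ ENNReal.ofReal δ) (hV : P V ≤ ENNReal.ofReal δ)
    (h : ∀ ω, ω ∉ U → ω ∉ V → ω ∈ good) : ENNReal.ofReal (1 - 2 * δ) ≤ P good := by
  have hcover : Set.univ ⊆ good ∪ (U ∪ V) := fun ω _ => by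
    by_contra hω
    simp only [Set.mem_union, not_or] at hω
    exact hω.1 (h ω hω.2.1 hω.2.2)
  have h3 := (measure_mono (μ := P) hcover).trans ((measure_union_le _ _).trans
    (add_le_add le_rfl ((measure_union_le _ _).trans (add_le_add hU hV))))
  rw [measure_univ, ← ENNReal.ofReal_add hδ hδ] at h3
  rw [ENNReal.ofReal_sub _ (by linarith), ENNReal.ofReal_one, tsub_le_iff_right, two_mul]
  exact h3

lemma γ_mul_B_sq_le_one (hB : 0 < M.B) : M.γ ^ 2 * M.B ^ 2 ≤ 1 := by
  rw [← mul_pow]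
  have h1 : 0 ≤ M.γ * M.B := by rw [Model.γ]; positivity
  refine pow_le_one₀ h1 ?_
  rw [Model.γ, one_div_mul_eq_div, div_le_one (by positivity)]
  linarith [Real.add_one_le_exp M.B, Real.exp_pos (-M.B)]

/-- The width bound of the elliptical potential argument, in terms of the information gain
`d log (1 + T / (d lam))`. -/
lemma width_bound {cLam ℓ u G w v T : ℝ} {d : ℕ} (hd : 0 < d) (hc : 0 < cLam) (hlam : 0 < lam)
    (hT : 0 < T) (hℓ : 1 / 2 ≤ ℓ) (hlb : cLam * (d * ℓ) ≤ lam) (hu : u = T / (d * lam))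
    (hG : G ≤ (1 + 4 / lam) * (4 * (d * Real.log (1 + u))))
    (hw1 : w ≤ 4 * T / lam) (hv1 : v ≤ 4 * T / lam)
    (hw2 : w / 2 - G ≤ 4 / lam * (2 * ℓ)) (hv2 : v / 2 - w ≤ 4 / lam * (2 * ℓ)) :
    w ≤ (16 + 224 / cLam) * (d * Real.log (1 + u)) ∧
      v ≤ (16 + 224 / cLam) * (d * Real.log (1 + u)) := by
  have hd1 : (1 : ℝ) ≤ d := by exact_mod_cast hd
  have hu0 : 0 < u := by rw [hu]; positivity
  set L := d * Real.log (1 + u) with hL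
  have hlog0 : 0 ≤ Real.log (1 + u) := Real.log_nonneg (by linarith)
  have hL0 : 0 ≤ L := by positivity
  have hcL : 0 ≤ L / cLam := by positivity
  have hexp : (16 + 224 / cLam) * L = 16 * L + 224 * (L / cLam) := by ring
  rw [hexp]
  have hlow : 1 - (1 + u)⁻¹ ≤ Real.log (1 + u) := Real.one_sub_inv_le_log_of_pos (by linarith)
  -- For u ≤ 1 the trivial bound 4T/λ = 4du is already of order d log(1 + u). For u > 1 one has L ≥
  -- 1/2, so terms of order 1/c_λ can be charged to L.
  rcases le_or_gt u 1 with h | h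
  · have h1 : u / 2 ≤ Real.log (1 + u) := by
      refine le_trans ?_ hlow
      have : 1 - (1 + u)⁻¹ = u / (1 + u) := by field_simp; ring
      rw [this]
      gcongr
      linarith
    have h2 : 4 * T / lam = 8 * (d * (u / 2)) := by rw [hu]; field_simp; ring
    have h3 : (d : ℝ) * (u / 2) ≤ L := by rw [hL]; gcongr
    constructor <;> linarith
  · have h1 : 1 / 2 ≤ L := by
      have h2 : (1 + u)⁻¹ ≤ 1 / 2 := by
        rw [one_div]
        exact inv_anti₀ (by norm_num) (by linarith)
      have : 1 / 2 ≤ Real.log (1 + u) := by linarith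
      rw [hL]
      nlinarith
    have hℓlam : ℓ / lam ≤ 1 / cLam := by
      rw [div_le_div_iff₀ hlam hc]
      nlinarith [mul_pos hc (by linarith : 0 < ℓ)]
    have hinv : 1 / lam ≤ 2 * (1 / cLam) := by
      have : 1 / lam * (1 / 2) ≤ ℓ / lam := by
        rw [div_mul_eq_mul_div, one_mul]
        gcongr
      linarith
    have hLc : 1 / cLam ≤ 2 * (L / cLam) := by
      rw [mul_div_assoc']
      gcongr
      linarith
    have h4 : 4 / lam * (2 * ℓ) ≤ 16 * (L / cLam) := by
      have : 4 / lam * (2 * ℓ) = 8 * (ℓ / lam) := by ring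
      linarith
    have hG' : G ≤ 4 * L + 32 * (L / cLam) := by
      refine hG.trans ?_
      have h5 : (1 + 4 / lam) * (4 * L) = 4 * L + 16 * (1 / lam * L) := by ring
      have h6 : 1 / lam * L ≤ 2 * (1 / cLam) * L := by gcongr
      have h7 : 2 * (1 / cLam) * L = 2 * (L / cLam) := by ring
      rw [h5]
      linarith
    -- In units of L and L/c_λ: w ≤ 2G + 32/c_λ gives (8, 96), and v ≤ 2w + 32/c_λ gives (16, 224).
    constructor <;> linarith

section Run

variable {Ω : Type*} [MeasurableSpace Ω] {P : Measure Ω} {alg : M.OptionII lam β} {T : ℕ}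
  {Z : ℕ → Ω → Round X A}

/-- With probability at least `1 - δ`, both the observed and the expected squared widths sum up to
at most a multiple of the information gain. -/
lemma IsRun.measure_lt_sum_width [IsProbabilityMeasure P] (hrun : IsRun alg P T Z)
    (hM : M.LinearAssumption) (hd : 0 < d) (hT : 0 < T) (hlam : 0 < lam) {δ cLam : ℝ}
    (hδ : 0 < δ) (hδ2 : δ ≤ 1 / 2) (hc : 0 < cLam)
    (hlb : cLam * (d * Real.log (T / δ) / (M.γ ^ 2 * M.B ^ 2)) ≤ lam) :
    P {ω | ¬ (∑ t ∈ Finset.range T, alg.width t (hist Z t ω) (Z t ω).1 ≤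
        (16 + 224 / cLam) * (d * Real.log (1 + T / (d * lam))) ∧
      ∑ t ∈ Finset.range T, ∫ x, alg.width t (hist Z t ω) x ∂M.d₀ ≤
        (16 + 224 / cLam) * (d * Real.log (1 + T / (d * lam))))} ≤ ENNReal.ofReal δ := by
  have := hM.prob_d₀
  have hT1 : (1 : ℝ) ≤ T := by exact_mod_cast hT
  have h1 := hrun.measure_log_le_sum
    (g := fun s D z => (alg.width s D z.1 / 2 - M.gain lam D z) / (4 / lam))
    (fun s => (((alg.measurable_width_round hM s).div_const _).sub
      (hM.measurable_gain lam s)).div_const _)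
    (fun s D => alg.stepLIntegral_exp_width_sub_gain hM hlam s D) (half_pos hδ)
  have h2 := hrun.measure_log_le_sum
    (g := fun s D z => ((∫ x, alg.width s D x ∂M.d₀) / 2 - alg.width s D z.1) / (4 / lam))
    (fun s => ((((alg.measurable_integral_width hM s).comp measurable_fst).div_const _).sub
      (alg.measurable_width_round hM s)).div_const _)
    (fun s D => alg.stepLIntegral_exp_integral_width_sub hM hlam s D) (half_pos hδ)
  refine (measure_mono ?_).trans ((measure_union_le _ _).trans ((add_le_add h1 h2).trans
    (le_of_eq ?_)))
  swap
  · rw [← ENNReal.ofReal_add (half_pos hδ).le (half_pos hδ).le, add_halves]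
  intro ω hω
  by_contra hnot
  refine hω ?_
  simp only [Set.mem_union, Set.mem_ofPred_eq, not_or, not_le, ← Finset.sum_div] at hnot
  obtain ⟨hw, hv⟩ := hnot
  have hm : 0 < 4 / lam := by positivity
  rw [div_lt_iff₀ hm, Finset.sum_sub_distrib, ← Finset.sum_div] at hw hv
  have hTδ : 1 / δ ≤ T / δ := by gcongr
  have hδinv : 2 ≤ 1 / δ := by rw [le_div_iff₀ hδ]; linarith
  have hℓ : 1 / 2 ≤ Real.log (T / δ) := by
    have := Real.log_le_log (by norm_num) (hδinv.trans hTδ)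
    linarith [Real.log_two_gt_d9]
  -- Each deviation inequality gets δ/2; since 1/δ ≥ 2, the resulting 2/δ is at most (T/δ)².
  have hlog : Real.log (1 / (δ / 2)) ≤ 2 * Real.log (T / δ) := by
    have h3 : 1 / (δ / 2) = 2 * (1 / δ) := by field_simp
    have h4 : 1 / (δ / 2) ≤ (T / δ) ^ 2 := by rw [h3]; nlinarith
    have h5 := Real.log_le_log (by positivity) h4
    rw [Real.log_pow] at h5
    exact_mod_cast h5
  have hlogm : Real.log (1 / (δ / 2)) * (4 / lam) ≤ 4 / lam * (2 * Real.log (T / δ)) := by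
    rw [mul_comm]
    gcongr
  have hγpos : 0 < M.γ ^ 2 * M.B ^ 2 := by
    have := hM.B_pos
    rw [Model.γ]
    positivity
  have hlb' : cLam * (d * Real.log (T / δ)) ≤ lam := by
    refine le_trans ?_ hlb
    gcongr
    rw [le_div_iff₀ hγpos]
    exact mul_le_of_le_one_right (by positivity) (γ_mul_B_sq_le_one hM.B_pos)
  have hbound : ∀ f : ℕ → ℝ, (∀ t, f t ≤ 4 / lam) →
      ∑ t ∈ Finset.range T, f t ≤ 4 * T / lam := fun f hf => by
    refine (Finset.sum_le_sum fun t _ => hf t).trans (le_of_eq ?_)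
    rw [Finset.sum_const, Finset.card_range, nsmul_eq_mul]
    ring
  refine width_bound hd hc hlam (by linarith) hℓ hlb' rfl
    (Model.sum_gain_le hM.norm_φ_le hd hlam (fun t => Z t ω) T)
    (hbound _ fun t => alg.width_le hM hlam t _ _) (hbound _ fun t => ?_)
    (hw.le.trans hlogm) (hv.le.trans hlogm)
  have := integral_mono (alg.integrable_width hM hlam t (hist Z t ω)) (integrable_const (4 / lam))
    fun x => alg.width_le hM hlam t (hist Z t ω) x
  simpa using this

end Run

end

end GSHF

/-! ### The main theorem -/

theorem mainTheorem4 :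
    ∃ cβ : ℝ, 0 < cβ ∧ ∀ cLam : ℝ, 0 < cLam → ∃ K : ℝ, 0 < K ∧
      ∀ (X A Ω : Type*) [MeasurableSpace X] [MeasurableSpace A] [MeasurableSpace Ω]
        (P : Measure Ω) [IsProbabilityMeasure P]
        (d T : ℕ) (M : GSHF.Model X A d) (δ lam β : ℝ),
        M.LinearAssumption → 0 < T → 0 < δ → δ < 1 → 0 < lam →
        cLam * (d * Real.log (T / δ) / (M.γ ^ 2 * M.B ^ 2)) ≤ lam →
        cβ * Real.sqrt (d * Real.log (T / δ) / M.γ ^ 2 + lam * M.B ^ 2) ≤ β →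
        ∀ (alg : M.OptionII lam β) (Z : ℕ → Ω → GSHF.Round X A) (πStar : GSHF.Policy X A),
          GSHF.IsRun alg P T Z → M.IsOptimal πStar →
          ENNReal.ofReal (1 - 2 * δ) ≤
            P {ω |
              GSHF.regretAve alg Z πStar T ω ≤
                  K * Real.sqrt (T * β ^ 2 * d * Real.log (1 + T / (d * lam)))
                    - M.η * GSHF.sumKL alg Z πStar T ω ∧
              GSHF.regret alg Z πStar T ω ≤
                  K * Real.sqrt (T * β ^ 2 * d * Real.log (1 + T / (d * lam)))
                    - M.η * GSHF.sumKL alg Z πStar T ω} := by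
  refine ⟨1000, by norm_num, fun cLam hc => ⟨2 * √(16 + 224 / cLam), by positivity, ?_⟩⟩
  intro X A Ω _ _ _ P _ d T M δ lam β hM hT hδ _ hlam hlb hβ alg Z πStar hrun hopt
  -- Above 1/2 the claimed probability is nonpositive; below, log(T/δ) ≥ log 2 stays away from 0.
  rcases lt_or_ge (1 / 2) δ with hδ2 | hδ2
  · rw [ENNReal.ofReal_of_nonpos (by linarith)]
    exact zero_le
  rcases Nat.eq_zero_or_pos d with rfl | hd
  · have h : ∀ ω, _ := fun ω => GSHF.regret_eq_zero_of_dim_zero (T := T) (Z := Z) (alg := alg) hM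
      hopt.1 ω
    refine (ENNReal.ofReal_le_one.2 (by linarith)).trans ?_
    simp [h]
  obtain ⟨θStar, hB, hθStar⟩ := hM.linear
  have hβ0 : 0 ≤ β := (by positivity : (0 : ℝ) ≤ _).trans hβ
  have h1 := hrun.measure_exists_lt_matNorm hM hd hT hlam hδ hδ2 hβ hB hθStar
  have h2 := hrun.measure_lt_sum_width hM hd hT hlam hδ hδ2 hc hlb
  set K₁ := 16 + 224 / cLam with hK₁
  have hK₁0 : 0 ≤ K₁ := by positivity
  have hsqrt : 2 * √K₁ * √(T * β ^ 2 * d * Real.log (1 + T / (d * lam))) =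
      2 * (β * √(T * (K₁ * (d * Real.log (1 + T / (d * lam)))))) := by
    have h3 : T * β ^ 2 * d * Real.log (1 + T / (d * lam)) =
        β ^ 2 * (T * (d * Real.log (1 + T / (d * lam)))) := by ring
    have h4 : T * (K₁ * (d * Real.log (1 + T / (d * lam)))) =
        K₁ * (T * (d * Real.log (1 + T / (d * lam)))) := by ring
    rw [h3, h4, Real.sqrt_mul (sq_nonneg β), Real.sqrt_sq hβ0, Real.sqrt_mul hK₁0]
    ring
  rw [hsqrt]
  refine GSHF.ofReal_one_sub_two_mul_le hδ.le h1 h2 fun ω ha hb => ?_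
  obtain ⟨hw, hv⟩ := not_not.1 hb
  refine GSHF.regret_le_of_confidence hM hlam hβ0 hθStar hopt (fun t ht => ?_) hw hv
  by_contra hlt
  exact ha ⟨t, ht, not_le.1 hlt⟩
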